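/- Let $B\subset\mathbb R^3$ be a closed round ball. A smooth vector field $F$ on $B$ is *positively unbalanced* if it points outwards at every point of $\partial B$. A *positive (negative) charge* of $F$ is a hyperbolic source (sink). A *negative (positive) null point* is a hyperbolic zero $p$ of $F$ with $\operatorname{div}F(p)=0$ at which exactly two (exactly one) of the three eigenvalues of $DF(p)$ have positive real part. A *separator* is a field line in $B$ that comes from a negative null point $q$ (as time tends to $-\infty$) and tends to a positive null point $p$ (as time tends to $+\infty$), and along which the two-dimensional unstable manifold of $q$ and the two-dimensional stable manifold of $p$ intersect transversally. Families of fields are continuous in the $C^\infty$ topology on $B$. Let $l\ge 2$. (a) Let $F_0$ be a positively unbalanced field on $B$ that has exactly $l$ positive charges and $l-1$ negative null points in $B$, and no other zeros. Then there is a continuous family $F_t$, $0\le t\le 1$, of positively unbalanced fields on $B$, starting at $F_0$ and equal to $F_0$ outside a compact subset of the interior of $B$, such that $F_1$ has exactly $l$ positive charges, $l$ negative null points and one positive null point in $B$, no other zeros, and exactly $l$ separators. (b) For every $l\ge2$ this is realized, for some ball $B$ centred at the origin and some $F_0$ as in (a), through a saddle-node bifurcation that is divergence-free near the origin. Namely,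 there is a continuous family $F_t$, $0\le t\le1$, of positively unbalanced fields on $B$ such that, with $U=\{|x|,|y|,|z|<\tfrac12\}$ and $U_1=\{|x|<0.9,\ |y|<0.9,\ |z|<1\}\subset \operatorname{int}B$, and with $\nu=\min(2t,1)$ and $\mu=\max\left(\tfrac{2t-1}{3},0\right)$: * $F_t=F_0$ on $B\setminus U_1$ for all $t$; * on $U$, for all $t$, $\operatorname{div}F_t\equiv0$ and $F_t$ is the field $\dot x=(\nu-1)^2-\mu x+\nu^2x^2$, $\dot y=-y$, $\dot z=z(1+\mu-2\nu^2x)$; * for $t<\tfrac12$ the field $F_t$ has the same zeros in $B$ as $F_0$: exactly $l$ positive charges, $l-1$ negative null points and no others; * for $t=\tfrac12$ there is exactly one additional zero, the origin; * for $t>\tfrac12$ the zeros are those of $F_0$ together with the origin, which is a positive null point, and $(\mu,0,0)$, which is a negative null point; in total $F_t$ has exactly $l$ positive charges, $l$ negative null points, one positive null point and no other zeros; * $F_1$ has exactly $l$ separators. -/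

import Mathlib

open Set Filter Topology
open scoped ContDiff

namespace MagneticGroup

/-- Euclidean three-space. Vector fields are maps `Space → Space`; only their values on the
closed ball under consideration matter. -/
abbrev Space : Type := EuclideanSpace ℝ (Fin 3)

noncomputable section

/-! ### Charges and null points -/

/-- The three complex eigenvalues, with multiplicity, of the linearization of `F` at `p`. -/
def eigenvalues (F : Space → Space) (p : Space) : Multiset ℂ :=
  ((fderiv ℝ F p : Space →ₗ[ℝ] Space).charpoly.map (algebraMap ℝ ℂ)).roots

/-- The divergence of `F` at `p`. -/
def divergence (F : Space → Space) (p : Space) : ℝ :=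
  LinearMap.trace ℝ Space (fderiv ℝ F p : Space →ₗ[ℝ] Space)

open scoped Classical in
/-- Morse index: the number of eigenvalues in the open right half-plane. -/
def morseIndex (F : Space → Space) (p : Space) : ℕ :=
  (eigenvalues F p).countP (fun z => 0 < z.re)

/-- `p` is a hyperbolic equilibrium of `F`. -/
def IsHyperbolicZero (F : Space → Space) (p : Space) : Prop :=
  F p = 0 ∧ ∀ z ∈ eigenvalues F p, z.re ≠ 0

/-- A positive charge: a source of the field. -/
def IsPositiveCharge (F : Space → Space) (p : Space) : Prop :=
  IsHyperbolicZero F p ∧ morseIndex F p = 3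

/-- A negative charge: a sink of the field. -/
def IsNegativeCharge (F : Space → Space) (p : Space) : Prop :=
  IsHyperbolicZero F p ∧ morseIndex F p = 0

/-- A positive null point: a conservative saddle (the eigenvalues have sum zero) with
one-dimensional unstable and two-dimensional stable separatrix. -/
def IsPositiveNull (F : Space → Space) (p : Space) : Prop :=
  IsHyperbolicZero F p ∧ morseIndex F p = 1 ∧ divergence F p = 0

/-- A negative null point: a conservative saddle with two-dimensional unstable and
one-dimensional stable separatrix. -/
def IsNegativeNull (F : Space → Space) (p : Space) : Prop :=
  IsHyperbolicZero F p ∧ morseIndex F p = 2 ∧ divergence F p = 0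

/-- The zeros of `F` in `B`. -/
def zeros (F : Space → Space) (B : Set Space) : Set Space := {p ∈ B | F p = 0}

/-- In `B` the field `F` has exactly `a` positive charges, `b` negative null points, `d` positive
null points, and no other zeros (in particular no negative charge). -/
structure HasCounts (F : Space → Space) (B : Set Space) (a b d : ℕ) : Prop where
  classified : ∀ p ∈ zeros F B, IsPositiveCharge F p ∨ IsNegativeNull F p ∨ IsPositiveNull F p
  positiveCharges : {p ∈ B | IsPositiveCharge F p}.encard = (a : ℕ∞)
  negativeNulls : {p ∈ B | IsNegativeNull F p}.encard = (b : ℕ∞)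
  positiveNulls : {p ∈ B | IsPositiveNull F p}.encard = (d : ℕ∞)

/-- The smooth field `F` on the closed ball with centre `c` and radius `R` is directed outwards on
the boundary sphere: the ball is a source region, and the group of charges in it is positively
unbalanced. -/
structure PositivelyUnbalanced (F : Space → Space) (c : Space) (R : ℝ) : Prop where
  radius_pos : 0 < R
  smooth : ContDiffOn ℝ ∞ F (Metric.closedBall c R)
  outward : ∀ x ∈ Metric.sphere c R, 0 < inner ℝ (F x) (x - c)

/-! ### Separators -/

/-- Stable manifold of `p` in `B`: the points whose forward field line stays in `B` and
converges to `p`. -/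
def stableSet (F : Space → Space) (B : Set Space) (p : Space) : Set Space :=
  {x | ∃ γ : ℝ → Space, γ 0 = x ∧
    (∀ s, 0 ≤ s → γ s ∈ B ∧ HasDerivWithinAt γ (F (γ s)) (Ici 0) s) ∧ Tendsto γ atTop (𝓝 p)}

/-- Unstable manifold of `p` in `B`: the points whose backward field line stays in `B` and
converges to `p`. -/
def unstableSet (F : Space → Space) (B : Set Space) (p : Space) : Set Space :=
  {x | ∃ γ : ℝ → Space, γ 0 = x ∧
    (∀ s, s ≤ 0 → γ s ∈ B ∧ HasDerivWithinAt γ (F (γ s)) (Iic 0) s) ∧ Tendsto γ atBot (𝓝 p)}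

/-- Tangent vectors at `x` to an (immersed) submanifold `W`: velocities at `x` of `C¹` curves
that run in `W` for small times. -/
def tangentVectors (W : Set Space) (x : Space) : Set Space :=
  {v | ∃ σ : ℝ → Space, ContDiff ℝ 1 σ ∧ σ 0 = x ∧ deriv σ 0 = v ∧ ∀ᶠ s in 𝓝 (0 : ℝ), σ s ∈ W}

/-- `W₁` and `W₂` intersect transversally at `x`. -/
def TransverseAt (W₁ W₂ : Set Space) (x : Space) : Prop :=
  Submodule.span ℝ (tangentVectors W₁ x ∪ tangentVectors W₂ x) = ⊤

/-- A (heteroclinic) separator of `F` in `B`: a field line connecting two null points, along which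
their two-dimensional separatrices intersect transversally. The line comes out of the fan of a
negative null point `q` and goes into the fan of a positive null point `p`. -/
def IsSeparator (F : Space → Space) (B : Set Space) (S : Set Space) : Prop :=
  ∃ q ∈ B, ∃ p ∈ B, IsNegativeNull F q ∧ IsPositiveNull F p ∧
    (∃ γ : ℝ → Space, (∀ s, γ s ∈ B ∧ HasDerivAt γ (F (γ s)) s) ∧
      Tendsto γ atBot (𝓝 q) ∧ Tendsto γ atTop (𝓝 p) ∧ S = range γ) ∧
    ∀ x ∈ S, TransverseAt (unstableSet F B q) (stableSet F B p) x

/-- The number of separators of `F` in `B`. -/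
def separatorCount (F : Space → Space) (B : Set Space) : ℕ∞ :=
  {S : Set Space | IsSeparator F B S}.encard

/-! ### Families of fields -/

/-- `F t`, `0 ≤ t ≤ 1`, is a family of smooth fields on `B`, continuous in the `C^∞` topology:
all derivatives in `x` depend jointly continuously on `(t, x)`. -/
structure IsContinuousFamily (F : ℝ → Space → Space) (B : Set Space) : Prop where
  smooth : ∀ t ∈ Icc (0 : ℝ) 1, ContDiffOn ℝ ∞ (F t) B
  continuous : ∀ k : ℕ, ContinuousOn
    (fun w : ℝ × Space => iteratedFDerivWithin ℝ k (F w.1) B w.2) (Icc (0 : ℝ) 1 ×ˢ B)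

/-- The box `|x| < 1/2`, `|y| < 1/2`, `|z| < 1/2`. -/
def innerBox : Set Space := {v | |v 0| < 1 / 2 ∧ |v 1| < 1 / 2 ∧ |v 2| < 1 / 2}

/-- The box `|x| < 0.9`, `|y| < 0.9`, `|z| < 1`. -/
def outerBox : Set Space := {v | |v 0| < 9 / 10 ∧ |v 1| < 9 / 10 ∧ |v 2| < 1}

/-- First parameter of the saddle-node family: it runs from `0` to `1` for `0 ≤ t ≤ 1/2`. -/
def nu (t : ℝ) : ℝ := min (2 * t) 1

/-- Second parameter of the saddle-node family: it runs from `0` to `1/3` for `1/2 ≤ t ≤ 1`. -/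
def mu (t : ℝ) : ℝ := max ((2 * t - 1) / 3) 0

/-- The saddle-node family: `x' = (ν - 1)² - μ x + ν² x²`, `y' = -y`, `z' = z (1 + μ - 2 ν² x)`. -/
def saddleNode (t : ℝ) (v : Space) : Space :=
  !₂[(nu t - 1) ^ 2 - mu t * v 0 + nu t ^ 2 * v 0 ^ 2,
    -v 1,
    v 2 * (1 + mu t - 2 * nu t ^ 2 * v 0)]

/-- The birth of a pair of null points near the origin by a saddle-node bifurcation at `t = 1/2`,
in the family `F t` of fields on the ball with centre `0` and radius `R`. The family is
stationary outside `outerBox`; in `innerBox` it is divergence-free and equal to the saddle-node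
family; the zeros of `F 0` persist, with a single additional zero, the origin, at `t = 1/2`, which
for `t > 1/2` decays into the origin and the point `(μ, 0, 0)`. -/
structure IsSaddleNodeBirth (F : ℝ → Space → Space) (R : ℝ) (l : ℕ) : Prop where
  outerBox_subset : outerBox ⊆ Metric.ball 0 R
  stationary : ∀ t ∈ Icc (0 : ℝ) 1, ∀ x ∈ Metric.closedBall (0 : Space) R \ outerBox,
    F t x = F 0 x
  explicit : ∀ t ∈ Icc (0 : ℝ) 1, ∀ x ∈ innerBox, F t x = saddleNode t x
  divergence_free : ∀ t ∈ Icc (0 : ℝ) 1, ∀ x ∈ innerBox, divergence (F t) x = 0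
  zeros_before : ∀ t ∈ Ico (0 : ℝ) (1 / 2),
    zeros (F t) (Metric.closedBall 0 R) = zeros (F 0) (Metric.closedBall 0 R)
  zeros_at : zeros (F (1 / 2)) (Metric.closedBall 0 R)
    = zeros (F 0) (Metric.closedBall 0 R) ∪ {0}
  zeros_after : ∀ t ∈ Ioc (1 / 2 : ℝ) 1, zeros (F t) (Metric.closedBall 0 R)
    = zeros (F 0) (Metric.closedBall 0 R) ∪ {0, !₂[mu t, 0, 0]}
  counts_before : ∀ t ∈ Ico (0 : ℝ) (1 / 2), HasCounts (F t) (Metric.closedBall 0 R) l (l - 1) 0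
  counts_after : ∀ t ∈ Ioc (1 / 2 : ℝ) 1, HasCounts (F t) (Metric.closedBall 0 R) l l 1
  origin_positive : ∀ t ∈ Ioc (1 / 2 : ℝ) 1, IsPositiveNull (F t) 0
  other_negative : ∀ t ∈ Ioc (1 / 2 : ℝ) 1, IsNegativeNull (F t) !₂[mu t, 0, 0]

end

end MagneticGroup

namespace MagneticGroup

/-! ### Ordinary differential equations -/

/-! Both parts rest on one explicit field, `model l m n`, glued by cutoffs. For |x| ≥ 3/5 and |y| ≤
1/2 it is x' = x + 2, y' = `profile l y`, z' = z. Its zeros there form a column on x = -2, z = 0,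
alternately sources (eigenvalues 1, 2, 1) and saddles (1, -2, 1). Near the origin it is the
saddle-node normal form. The first two components are convex combinations of their pieces and z' is
z times a factor, which is why gluing creates no further zeros (`model_eq_zero`); the field points
outwards from radius 4 on (`inner_model_pos`). Part (b) is this field on the ball of radius 4, with
m, n driven by `mu`, `nu`.

The separators of the final field m = 1/3, n = 1 are found by reduction to the plane z = 0. Since z'
= z · `rate` with `rate` ≥ 1/10, a field line tending to the origin lies in that plane. There a
strip |y| ≤ Y, with Y above all the saddles and below the top source, is forward invariant, and its
part -2 < x < 1/3 flows to the origin (`IsOrbit.forward`). All l - 1 saddles, and the new negative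
null point (1/3, 0, 0), lie on the edges of this region. A field line leaving one of them in the
plane must run along its x-direction; one branch goes to the origin and the other never does. So
each of the l negative null points has exactly one separator (`exists_separatrix`).

The intersection is transverse because the stable manifold of the origin contains a planar
neighbourhood of the separator, while the unstable manifold contains a vertical segment through each
of its points: near the plane the horizontal motion does not see z, so a separator can be lifted
(`exists_backward_of_lift`).

For part (a) a scaled copy of the final field is pasted into the ball along a collar where the given
field points outwards. In the collar the result is a convex combination of two outward fields, so it
has no zeros there and no field line comes in through it (`exists_family_to_containsModel`). Zeros
and separators are therefore those of the copy; `ContainsModel` expresses this situation, and its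
count of separators serves both parts. -/

theorem exists_forall_hasDerivAt_of_lipschitzWith {E : Type*} [NormedAddCommGroup E]
    [NormedSpace ℝ E] [CompleteSpace E] {v : E → E} {K : NNReal} (hK : LipschitzWith K v)
    (hv : ContDiff ℝ 1 v) (x : E) :
    ∃ γ : ℝ → E, γ 0 = x ∧ ∀ t, HasDerivAt γ (v (γ t)) t := by
  have hv' : ContMDiff (modelWithCornersSelf ℝ E) (modelWithCornersSelf ℝ E).tangent 1
      (fun x ↦ (⟨x, v x⟩ : TangentBundle (modelWithCornersSelf ℝ E) E)) :=
    contMDiff_vectorSpace_iff_contDiff.2 hv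
  -- On the ball of radius ‖v x‖ + 1 about x the speed is at most (‖v x‖ + 1)(1 + K). Radius over
  -- speed is 1 / (1 + K), independent of x, and a uniform existence time makes solutions global.
  have hε : (0 : ℝ) < 1 / (1 + K) := by positivity
  obtain ⟨γ, h0, hγ⟩ := exists_isMIntegralCurve_of_isMIntegralCurveOn hv' hε (fun x => by
    have hpl : IsPicardLindelof (fun _ : ℝ => v)
        (⟨0, by constructor <;> linarith⟩ : Icc (-(1 / (1 + (K : ℝ)))) (1 / (1 + (K : ℝ)))) x
        (‖v x‖₊ + 1) 0 ((‖v x‖₊ + 1) * (1 + K)) K := by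
      refine IsPicardLindelof.of_time_independent (fun y hy => ?_) hK.lipschitzOnWith ?_
      · rw [mem_closedBall_iff_norm] at hy
        have h1 := hK.norm_sub_le y x
        have h2 := norm_le_norm_add_norm_sub' (v y) (v x)
        push_cast at hy ⊢
        have h3 : (K : ℝ) * ‖y - x‖ ≤ K * (‖v x‖ + 1) := by gcongr
        linarith
      · push_cast
        rw [sub_zero, zero_sub, neg_neg, max_self]
        field_simp
        simp
    obtain ⟨α, h0, hα⟩ := hpl.exists_eq_forall_mem_Icc_hasDerivWithinAt₀
    refine ⟨α, h0, fun t ht => ?_⟩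
    exact ((hα t (Ioo_subset_Icc_self ht)).mono Ioo_subset_Icc_self).hasFDerivWithinAt.hasMFDerivWithinAt) x
  refine ⟨γ, h0, fun t => ?_⟩
  have h : HasFDerivAt γ (ContinuousLinearMap.smulRight (1 : ℝ →L[ℝ] ℝ) (v (γ t))) t :=
    hasMFDerivAt_iff_hasFDerivAt.1 (hγ t)
  simpa using h.hasDerivAt

theorem eq_of_hasDerivAt_of_eq {E : Type*} [NormedAddCommGroup E] [NormedSpace ℝ E]
    {v : E → E} {K : NNReal} (hK : LipschitzWith K v) {f g : ℝ → E}
    (hf : ∀ t, HasDerivAt f (v (f t)) t) (hg : ∀ t, HasDerivAt g (v (g t)) t) {t₀ : ℝ}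
    (h : f t₀ = g t₀) : f = g :=
  ODE_solution_unique_univ (v := fun _ => v) (s := fun _ => univ)
    (fun _ => hK.lipschitzOnWith) (fun t => ⟨hf t, trivial⟩) (fun t => ⟨hg t, trivial⟩) h

/-- A differentiable function that decreases wherever it takes the value `b` stays below `b`. -/
theorem le_of_deriv_neg_of_eq {f f' : ℝ → ℝ} {a b : ℝ}
    (hf : ∀ s, a ≤ s → HasDerivAt f (f' s) s) (ha : f a ≤ b)
    (h : ∀ s, a ≤ s → f s = b → f' s < 0) : ∀ s, a ≤ s → f s ≤ b := by
  intro s hs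
  refine image_le_of_deriv_right_lt_deriv_boundary (f' := f') (B := fun _ => b) (B' := fun _ => 0)
    (fun x hx => (hf x hx.1).continuousAt.continuousWithinAt)
    (fun x hx => (hf x hx.1).hasDerivWithinAt) ha (fun x => hasDerivAt_const x b)
    (fun x hx => h x hx.1) (right_mem_Icc.2 hs)

theorem le_of_deriv_pos_of_eq {f f' : ℝ → ℝ} {a b : ℝ}
    (hf : ∀ s, a ≤ s → HasDerivAt f (f' s) s) (ha : b ≤ f a)
    (h : ∀ s, a ≤ s → f s = b → 0 < f' s) : ∀ s, a ≤ s → b ≤ f s := by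
  intro s hs
  have := le_of_deriv_neg_of_eq (f := fun s => -f s) (b := -b) (fun s hs => (hf s hs).neg)
    (neg_le_neg ha) (fun s hs e => neg_lt_zero.2 (h s hs (neg_injective e))) s hs
  exact neg_le_neg_iff.1 this

/-- A solution of `u' ≤ -k u` with `k > 0`, `u ≥ 0` tends to zero. -/
theorem tendsto_zero_of_deriv_le {f f' : ℝ → ℝ} {a k : ℝ} (hk : 0 < k)
    (hf : ∀ s, a ≤ s → HasDerivAt f (f' s) s) (h0 : ∀ s, a ≤ s → 0 ≤ f s)
    (h : ∀ s, a ≤ s → f' s ≤ -k * f s) : Tendsto f atTop (𝓝 0) := by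
  have hd : ∀ s, a ≤ s → HasDerivAt (fun s => f s * Real.exp (k * s))
      (f' s * Real.exp (k * s) + f s * (Real.exp (k * s) * k)) s := fun s hs => by
    refine (hf s hs).mul ?_
    simpa using ((hasDerivAt_id s).const_mul k).exp
  have hanti : AntitoneOn (fun s => f s * Real.exp (k * s)) (Ici a) := by
    refine antitoneOn_of_hasDerivWithinAt_nonpos (convex_Ici a)
      (fun s hs => (hd s hs).continuousAt.continuousWithinAt)
      (fun s hs => (hd s (interior_subset hs)).hasDerivWithinAt) (fun s hs => ?_)
    have := h s (interior_subset hs)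
    have he := Real.exp_pos (k * s)
    nlinarith
  have hlim : Tendsto (fun s => (f a * Real.exp (k * a)) * Real.exp (-(k * s))) atTop (𝓝 0) := by
    have : Tendsto (fun s : ℝ => Real.exp (-(k * s))) atTop (𝓝 0) :=
      Real.tendsto_exp_neg_atTop_nhds_zero.comp (tendsto_id.const_mul_atTop hk)
    simpa using this.const_mul (f a * Real.exp (k * a))
  refine squeeze_zero' ((eventually_ge_atTop a).mono h0) ?_ hlim
  filter_upwards [eventually_ge_atTop a] with s hs
  have h1 := hanti (mem_Ici.2 le_rfl) hs hs
  have h2 : f s = f s * Real.exp (k * s) * Real.exp (-(k * s)) := by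
    rw [mul_assoc, ← Real.exp_add]; simp
  rw [h2]
  gcongr

theorem eq_const_mul_exp_of_hasDerivAt {f : ℝ → ℝ} {a : ℝ}
    (hf : ∀ s, s ≤ a → HasDerivAt f (f s) s) :
    ∀ s, s ≤ a → f s = f a * Real.exp (s - a) := by
  intro s hs
  have hd : ∀ s, s ≤ a → HasDerivAt (fun s => f s * Real.exp (-s)) 0 s := fun s hs => by
    have := (hf s hs).mul (hasDerivAt_neg s).exp
    refine this.congr_deriv ?_
    ring
  have hc : f s * Real.exp (-s) = f a * Real.exp (-a) := by
    refine (constant_of_derivWithin_zero (f := fun s => f s * Real.exp (-s)) (a := s) (b := a)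
      (fun x hx => (hd x hx.2).differentiableAt.differentiableWithinAt) (fun x hx => ?_) a
      (right_mem_Icc.2 hs)).symm
    exact (hd x hx.2.le).hasDerivWithinAt.derivWithin
      (uniqueDiffOn_Icc (hx.1.trans_lt hx.2) x ⟨hx.1, hx.2.le⟩)
  have : f s = f s * Real.exp (-s) * Real.exp s := by rw [mul_assoc, ← Real.exp_add]; simp
  rw [this, hc, mul_assoc, ← Real.exp_add]
  ring_nf

/-- A nonnegative function that is nonincreasing on `(-∞, a]` and tends to zero at `-∞`
vanishes. -/
theorem eq_zero_of_deriv_nonpos_of_tendsto_atBot {f f' : ℝ → ℝ} {a : ℝ}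
    (hf : ∀ s, s ≤ a → HasDerivAt f (f' s) s) (h0 : ∀ s, s ≤ a → 0 ≤ f s)
    (h : ∀ s, s ≤ a → f' s ≤ 0) (hl : Tendsto f atBot (𝓝 0)) : ∀ s, s ≤ a → f s = 0 := by
  have hanti : AntitoneOn f (Iic a) := by
    refine antitoneOn_of_hasDerivWithinAt_nonpos (convex_Iic a)
      (fun s hs => (hf s hs).continuousAt.continuousWithinAt)
      (fun s hs => (hf s (interior_subset (s := Iic a) hs)).hasDerivWithinAt)
      (fun s hs => h s (interior_subset (s := Iic a) hs))
  intro s hs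
  refine le_antisymm (ge_of_tendsto hl ?_) (h0 s hs)
  filter_upwards [eventually_le_atBot s] with r hr
  exact hanti (hr.trans hs) hs hr

/-! ### Families of fields depending affinely on coefficients -/

/-- Spatial derivatives do not touch the coefficients, so joint continuity splits into continuity in
t and continuity in x. Both families of the theorem are finite sums of this kind. -/
theorem isContinuousFamily_sum_smul {ι : Type*} (u : Finset ι) {a : ι → ℝ → ℝ}
    {G : ι → Space → Space} {B : Set Space} (hB : UniqueDiffOn ℝ B)
    (ha : ∀ i ∈ u, Continuous (a i)) (hG : ∀ i ∈ u, ContDiffOn ℝ ∞ (G i) B) :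
    IsContinuousFamily (fun t => ∑ i ∈ u, a i t • G i) B := by
  have hs : ∀ t : ℝ, ∀ i ∈ u, ContDiffOn ℝ ∞ (a i t • G i) B :=
    fun t i hi => (hG i hi).const_smul (a i t)
  constructor
  · intro t _
    have := ContDiffOn.sum (hs t)
    convert this using 1
    ext x : 1
    simp
  · intro k
    have hk : ((k : ℕ∞) : WithTop ℕ∞) ≤ ∞ := by exact_mod_cast le_top
    have : ∀ w ∈ Icc (0 : ℝ) 1 ×ˢ B,
        iteratedFDerivWithin ℝ k (∑ i ∈ u, a i w.1 • G i) B w.2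
          = ∑ i ∈ u, a i w.1 • iteratedFDerivWithin ℝ k (G i) B w.2 := by
      intro w hw
      rw [iteratedFDerivWithin_sum_apply hB hw.2
        (fun i hi => ((hs w.1 i hi).of_le hk) w.2 hw.2)]
      refine Finset.sum_congr rfl fun i hi => ?_
      exact iteratedFDerivWithin_const_smul_apply (((hG i hi).of_le hk) w.2 hw.2) hB hw.2
    refine ContinuousOn.congr ?_ this
    refine continuousOn_finsetSum _ fun i hi => ContinuousOn.smul
      ((ha i hi).comp continuous_fst).continuousOn ?_
    exact ((hG i hi).continuousOn_iteratedFDerivWithin hk hB).comp continuousOn_snd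
      (fun w hw => hw.2)

/-! ### Eigenvalues of triangular linearizations -/

section Triangular

variable {F : Space → Space} {p : Space} {L : Space →L[ℝ] Space} {a b d e : ℝ}

/-- This is the shape of the linearization of the model at each of its zeros: x and y decouple, and
`e` comes from the x-dependence of the expansion rate of z. The eigenvalues are the diagonal
entries. -/
theorem toMatrix_of_triangular (hL : ∀ v, L v = !₂[a * v 0, b * v 1, e * v 0 + d * v 2]) :
    LinearMap.toMatrix (EuclideanSpace.basisFun (Fin 3) ℝ).toBasis
      (EuclideanSpace.basisFun (Fin 3) ℝ).toBasis (L : Space →ₗ[ℝ] Space)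
      = !![a, 0, 0; 0, b, 0; e, 0, d] := by
  ext i j
  rw [LinearMap.toMatrix_apply]
  simp only [OrthonormalBasis.coe_toBasis, ContinuousLinearMap.coe_coe, hL,
    OrthonormalBasis.coe_toBasis_repr_apply, EuclideanSpace.basisFun_repr,
    EuclideanSpace.basisFun_apply]
  fin_cases i <;> fin_cases j <;> simp

theorem divergence_of_triangular (h : HasFDerivAt F L p)
    (hL : ∀ v, L v = !₂[a * v 0, b * v 1, e * v 0 + d * v 2]) :
    divergence F p = a + b + d := by
  rw [divergence, h.fderiv, LinearMap.trace_eq_matrix_trace ℝ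
    (EuclideanSpace.basisFun (Fin 3) ℝ).toBasis, toMatrix_of_triangular hL, Matrix.trace_fin_three]
  simp

theorem eigenvalues_of_triangular (h : HasFDerivAt F L p)
    (hL : ∀ v, L v = !₂[a * v 0, b * v 1, e * v 0 + d * v 2]) :
    eigenvalues F p = {(a : ℂ), (b : ℂ), (d : ℂ)} := by
  have hc : (L : Space →ₗ[ℝ] Space).charpoly.map (algebraMap ℝ ℂ)
      = (({(a : ℂ), (b : ℂ), (d : ℂ)} : Multiset ℂ).map
        (fun z => Polynomial.X - Polynomial.C z)).prod := by
    rw [← LinearMap.charpoly_toMatrix _ (EuclideanSpace.basisFun (Fin 3) ℝ).toBasis,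
      toMatrix_of_triangular hL, Matrix.charpoly, Matrix.det_fin_three]
    simp [mul_assoc]
  rw [eigenvalues, h.fderiv, hc, Polynomial.roots_multiset_prod_X_sub_C]

theorem morseIndex_of_triangular (h : HasFDerivAt F L p)
    (hL : ∀ v, L v = !₂[a * v 0, b * v 1, e * v 0 + d * v 2]) :
    morseIndex F p = (if 0 < a then 1 else 0) + (if 0 < b then 1 else 0)
      + (if 0 < d then 1 else 0) := by
  classical
  rw [morseIndex, eigenvalues_of_triangular h hL]
  simp only [Multiset.insert_eq_cons, Multiset.countP_cons, ← Multiset.cons_zero,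
    Multiset.countP_zero, Complex.ofReal_re]
  ring

theorem isHyperbolicZero_of_triangular (h0 : F p = 0) (h : HasFDerivAt F L p)
    (hL : ∀ v, L v = !₂[a * v 0, b * v 1, e * v 0 + d * v 2]) (ha : a ≠ 0) (hb : b ≠ 0)
    (hd : d ≠ 0) : IsHyperbolicZero F p := by
  refine ⟨h0, ?_⟩
  rw [eigenvalues_of_triangular h hL]
  simp [ha, hb, hd]

end Triangular

/-! ### Counting -/

/-- Counts from a list of the zeros and their types. -/
theorem hasCounts_of_zeros {F : Space → Space} {B S N P : Set Space} {a b d : ℕ}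
    (hB : S ∪ N ∪ P ⊆ B) (hz : ∀ v ∈ B, F v = 0 → v ∈ S ∪ N ∪ P)
    (hS : ∀ v ∈ S, IsPositiveCharge F v) (hN : ∀ v ∈ N, IsNegativeNull F v)
    (hP : ∀ v ∈ P, IsPositiveNull F v) (cS : S.encard = a) (cN : N.encard = b)
    (cP : P.encard = d) : HasCounts F B a b d := by
  have e1 : {p ∈ B | IsPositiveCharge F p} = S := by
    ext v
    refine ⟨fun hv => ?_, fun hv => ⟨hB (.inl (.inl hv)), hS v hv⟩⟩
    rcases hz v hv.1 hv.2.1.1 with (h | h) | h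
    · exact h
    · have := hv.2.2.symm.trans (hN v h).2.1; omega
    · have := hv.2.2.symm.trans (hP v h).2.1; omega
  have e2 : {p ∈ B | IsNegativeNull F p} = N := by
    ext v
    refine ⟨fun hv => ?_, fun hv => ⟨hB (.inl (.inr hv)), hN v hv⟩⟩
    rcases hz v hv.1 hv.2.1.1 with (h | h) | h
    · have := hv.2.2.1.symm.trans (hS v h).2; omega
    · exact h
    · have := hv.2.2.1.symm.trans (hP v h).2.1; omega
  have e3 : {p ∈ B | IsPositiveNull F p} = P := by
    ext v
    refine ⟨fun hv => ?_, fun hv => ⟨hB (.inr hv), hP v hv⟩⟩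
    rcases hz v hv.1 hv.2.1.1 with (h | h) | h
    · have := hv.2.2.1.symm.trans (hS v h).2; omega
    · have := hv.2.2.1.symm.trans (hN v h).2.1; omega
    · exact h
  refine ⟨fun v hv => ?_, e1 ▸ cS, e2 ▸ cN, e3 ▸ cP⟩
  rcases hz v hv.1 hv.2 with (h | h) | h
  · exact .inl (hS v h)
  · exact .inr (.inl (hN v h))
  · exact .inr (.inr (hP v h))

/-! ### The model field -/

/-- A smooth cutoff function: one for `|x| ≤ 1/2`, zero for `|x| ≥ 3/5`. -/
noncomputable def cutoff : ℝ → ℝ :=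
  (⟨1 / 2, 3 / 5, by norm_num, by norm_num⟩ : ContDiffBump (0 : ℝ))

/-- A smooth cutoff function: one for `|y| ≤ 1/2`, zero for `|y| ≥ 1/2 + 1 / (4 (l + 1))`. -/
noncomputable def tightCutoff (l : ℕ) : ℝ → ℝ :=
  (⟨1 / 2, 1 / 2 + 1 / (4 * (l + 1)), by norm_num, by
    have : (0 : ℝ) < 1 / (4 * (l + 1)) := by positivity
    linarith⟩ : ContDiffBump (0 : ℝ))

theorem contDiff_cutoff {n : ℕ∞} : ContDiff ℝ n cutoff := ContDiffBump.contDiff _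

theorem contDiff_tightCutoff (l : ℕ) {n : ℕ∞} : ContDiff ℝ n (tightCutoff l) :=
  ContDiffBump.contDiff _

theorem hasCompactSupport_cutoff : HasCompactSupport cutoff := ContDiffBump.hasCompactSupport _

theorem hasCompactSupport_tightCutoff (l : ℕ) : HasCompactSupport (tightCutoff l) :=
  ContDiffBump.hasCompactSupport _

theorem cutoff_nonneg (x : ℝ) : 0 ≤ cutoff x := ContDiffBump.nonneg _

theorem cutoff_le_one (x : ℝ) : cutoff x ≤ 1 := ContDiffBump.le_one _

theorem tightCutoff_nonneg (l : ℕ) (x : ℝ) : 0 ≤ tightCutoff l x := ContDiffBump.nonneg _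

theorem tightCutoff_le_one (l : ℕ) (x : ℝ) : tightCutoff l x ≤ 1 := ContDiffBump.le_one _

theorem cutoff_eq_one {x : ℝ} (h : |x| ≤ 1 / 2) : cutoff x = 1 :=
  ContDiffBump.one_of_mem_closedBall _ (by simpa using h)

theorem cutoff_eq_zero {x : ℝ} (h : 3 / 5 ≤ |x|) : cutoff x = 0 :=
  ContDiffBump.zero_of_le_dist _ (by simpa using h)

theorem tightCutoff_eq_one {l : ℕ} {x : ℝ} (h : |x| ≤ 1 / 2) : tightCutoff l x = 1 :=
  ContDiffBump.one_of_mem_closedBall _ (by simpa using h)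

theorem tightCutoff_eq_zero {l : ℕ} {x : ℝ} (h : 1 / 2 + 1 / (4 * ((l : ℝ) + 1)) ≤ |x|) :
    tightCutoff l x = 0 :=
  ContDiffBump.zero_of_le_dist _ (by simpa using h)

/-- A sinusoidal profile whose `2 l - 1` zeros in `[-1/2, 1/2]` have slopes alternating between
`2` and `-2`, the outermost slopes being `2`. -/
noncomputable def profile (l : ℕ) (y : ℝ) : ℝ :=
  2 / (Real.pi * (2 * l - 1)) * Real.sin (Real.pi * ((2 * l - 1) * y - (l - 1)))

theorem contDiff_profile (l : ℕ) {n : ℕ∞} : ContDiff ℝ n (profile l) := by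
  unfold profile
  have := Real.contDiff_sin (n := n)
  fun_prop

theorem profile_neg (l : ℕ) (y : ℝ) : profile l (-y) = -profile l y := by
  unfold profile
  rw [← mul_neg, ← Real.sin_neg]
  congr 1
  -- The two arguments differ by 2π(l - 1), written as l periods minus one to avoid natural
  -- subtraction.
  rw [← Real.sin_sub_nat_mul_two_pi (-(Real.pi * ((2 * l - 1) * y - (l - 1)))) l,
    ← Real.sin_add_two_pi (-(Real.pi * ((2 * l - 1) * y - (l - 1))) - l * (2 * Real.pi))]
  · congr 1
    ring

theorem hasDerivAt_profile {l : ℕ} (hl : 1 ≤ l) (y : ℝ) :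
    HasDerivAt (profile l) (2 * Real.cos (Real.pi * ((2 * l - 1) * y - (l - 1)))) y := by
  have hl' : (1 : ℝ) ≤ l := by exact_mod_cast hl
  have hN : (2 * (l : ℝ) - 1) ≠ 0 := by linarith
  have h := ((((hasDerivAt_id y).const_mul (2 * (l : ℝ) - 1)).sub_const ((l : ℝ) - 1)).const_mul
    Real.pi).sin.const_mul (2 / (Real.pi * (2 * l - 1)))
  refine h.congr_deriv ?_
  have := Real.pi_ne_zero
  simp only [id]
  field_simp

theorem abs_profile_le {l : ℕ} (hl : 1 ≤ l) (y : ℝ) : |profile l y| ≤ 1 := by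
  have hl' : (1 : ℝ) ≤ l := by exact_mod_cast hl
  have hpi := Real.pi_gt_three
  have h2 : 2 / (Real.pi * (2 * l - 1)) ≤ 1 := by
    rw [div_le_one (by nlinarith)]; nlinarith
  have h0 : 0 ≤ 2 / (Real.pi * (2 * (l : ℝ) - 1)) := by
    apply div_nonneg zero_le_two; nlinarith
  rw [profile, abs_mul, abs_of_nonneg h0]
  exact mul_le_one₀ h2 (abs_nonneg _) (Real.abs_sin_le_one _)

/-- Positivity of the profile between its outermost zero and the end of the cutoff region. -/
theorem profile_pos {l : ℕ} (hl : 1 ≤ l) {y : ℝ} (h1 : 1 / 2 ≤ y)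
    (h2 : y < 1 / 2 + 1 / (4 * ((l : ℝ) + 1))) : 0 < profile l y := by
  have hl' : (1 : ℝ) ≤ l := by exact_mod_cast hl
  have hpi := Real.pi_pos
  have hq : (2 * (l : ℝ) - 1) * (1 / (4 * (l + 1))) ≤ 1 / 2 := by
    rw [mul_one_div, div_le_iff₀ (by linarith)]; linarith
  refine mul_pos (div_pos two_pos (by nlinarith)) (Real.sin_pos_of_pos_of_lt_pi ?_ ?_)
  · apply mul_pos hpi; nlinarith
  · have : ((2 * (l : ℝ) - 1) * y - (l - 1)) < 1 := by nlinarith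
    nlinarith

/-- Negativity of the profile between the outermost zero and the next one. -/
theorem profile_neg_of_mem {l : ℕ} (hl : 1 ≤ l) {y : ℝ} (h1 : (l : ℝ) - 2 < (2 * l - 1) * y)
    (h2 : (2 * l - 1) * y < (l : ℝ) - 1) : profile l y < 0 := by
  have hl' : (1 : ℝ) ≤ l := by exact_mod_cast hl
  have hpi := Real.pi_pos
  refine mul_neg_of_pos_of_neg (div_pos two_pos (by nlinarith))
    (Real.sin_neg_of_neg_of_neg_pi_lt ?_ ?_)
  · apply mul_neg_of_pos_of_neg hpi; linarith
  · nlinarith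

/-! ### Zeros of the profile -/

/-- The height of the `i`-th source. -/
noncomputable def sourceHeight (l i : ℕ) : ℝ := (l - 1 - 2 * i) / (2 * l - 1)

/-- The height of the `i`-th saddle. -/
noncomputable def saddleHeight (l i : ℕ) : ℝ := (l - 2 - 2 * i) / (2 * l - 1)

/-- The zeros are y = (n + l - 1) / (2l - 1) with n an integer, and |y| ≤ 1/2 leaves -(2l - 1) < n <
1. Even n = -2i gives a source, odd n = -2i - 1 a saddle. -/
theorem exists_of_profile_eq_zero {l : ℕ} (hl : 1 ≤ l) {y : ℝ} (hy : |y| ≤ 1 / 2)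
    (h : profile l y = 0) :
    (∃ i < l, y = sourceHeight l i) ∨ ∃ i < l - 1, y = saddleHeight l i := by
  have hl' : (1 : ℝ) ≤ l := by exact_mod_cast hl
  have hpi := Real.pi_pos
  have hN : 0 < (2 * (l : ℝ) - 1) := by linarith
  have h0 : Real.sin (Real.pi * ((2 * l - 1) * y - (l - 1))) = 0 :=
    (mul_eq_zero.1 h).resolve_left (div_pos two_pos (by nlinarith)).ne'
  obtain ⟨n, hn⟩ := Real.sin_eq_zero_iff.1 h0
  have hn' : (n : ℝ) = (2 * l - 1) * y - (l - 1) := by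
    rw [mul_comm] at hn
    exact mul_left_cancel₀ hpi.ne' hn
  obtain ⟨hy1, hy2⟩ := abs_le.1 hy
  have b1 : (n : ℝ) < 1 := by nlinarith
  have b2 : (-(2 * l - 1 : ℤ) : ℝ) < n := by push_cast; nlinarith
  have b1' : n < 1 := by exact_mod_cast b1
  have b2' : -(2 * l - 1 : ℤ) < n := by exact_mod_cast b2
  have key : y = (n + (l - 1)) / (2 * l - 1) := by
    rw [hn']; field_simp; ring
  rcases Int.even_or_odd' n with ⟨k, hk | hk⟩
  · left
    refine ⟨(-k).toNat, by omega, ?_⟩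
    have hk' : (((-k).toNat : ℤ) : ℝ) = ((-k : ℤ) : ℝ) := by
      rw [Int.toNat_of_nonneg (by omega)]
    rw [key, sourceHeight, hk]
    push_cast at hk' ⊢
    rw [hk']; ring
  · right
    refine ⟨(-k - 1).toNat, by omega, ?_⟩
    have hk' : (((-k - 1).toNat : ℤ) : ℝ) = ((-k - 1 : ℤ) : ℝ) := by
      rw [Int.toNat_of_nonneg (by omega)]
    rw [key, saddleHeight, hk]
    push_cast at hk' ⊢
    rw [hk']; ring

theorem abs_sourceHeight_lt {l i : ℕ} (hi : i < l) : |sourceHeight l i| < 1 / 2 := by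
  have hi' : (i : ℝ) + 1 ≤ l := by exact_mod_cast hi
  have h0 : (0 : ℝ) ≤ i := by positivity
  have hN : 0 < (2 * (l : ℝ) - 1) := by linarith
  rw [sourceHeight, abs_lt, lt_div_iff₀ hN, div_lt_iff₀ hN]
  constructor <;> linarith

theorem abs_saddleHeight_le {l i : ℕ} (hi : i < l - 1) :
    |saddleHeight l i| ≤ (l - 2) / (2 * l - 1) := by
  have hi'' : i + 2 ≤ l := by omega
  have hi' : (i : ℝ) + 2 ≤ l := by exact_mod_cast hi''
  have h0 : (0 : ℝ) ≤ i := by positivity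
  have hN : 0 < (2 * (l : ℝ) - 1) := by linarith
  rw [saddleHeight, abs_div, abs_of_pos hN]
  gcongr
  rw [abs_le]
  constructor <;> linarith

theorem abs_saddleHeight_lt {l i : ℕ} (hi : i < l - 1) : |saddleHeight l i| < 1 / 2 := by
  refine (abs_saddleHeight_le hi).trans_lt ?_
  have hi'' : 1 ≤ l := by omega
  have hi' : (1 : ℝ) ≤ l := by exact_mod_cast hi''
  rw [div_lt_iff₀ (by linarith)]
  linarith

theorem cos_sourceHeight {l : ℕ} (hl : 1 ≤ l) (i : ℕ) :
    Real.cos (Real.pi * ((2 * l - 1) * sourceHeight l i - (l - 1))) = 1 := by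
  have hl' : (1 : ℝ) ≤ l := by exact_mod_cast hl
  have hN : (2 * (l : ℝ) - 1) ≠ 0 := by linarith
  have : Real.pi * ((2 * l - 1) * sourceHeight l i - (l - 1)) = 0 - i * (2 * Real.pi) := by
    rw [sourceHeight, mul_div_cancel₀ _ hN]; ring
  rw [this, Real.cos_sub_nat_mul_two_pi, Real.cos_zero]

/-- Centred at a saddle, the profile is minus a sine, whatever the index. This gives the zero and
also the attracting sign on both sides of it. -/
theorem profile_add_saddleHeight {l : ℕ} (hl : 1 ≤ l) (i : ℕ) (y : ℝ) :
    profile l (y + saddleHeight l i)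
      = -(2 / (Real.pi * (2 * l - 1)) * Real.sin (Real.pi * ((2 * l - 1) * y))) := by
  have hl' : (1 : ℝ) ≤ l := by exact_mod_cast hl
  have hN : (2 * (l : ℝ) - 1) ≠ 0 := by linarith
  have : Real.pi * ((2 * l - 1) * (y + saddleHeight l i) - (l - 1))
      = (Real.pi * ((2 * l - 1) * y) - Real.pi) - i * (2 * Real.pi) := by
    rw [mul_add, saddleHeight, mul_div_cancel₀ _ hN]; ring
  rw [profile, this, Real.sin_sub_nat_mul_two_pi, Real.sin_sub_pi]
  ring

theorem profile_saddleHeight {l : ℕ} (hl : 1 ≤ l) (i : ℕ) : profile l (saddleHeight l i) = 0 := by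
  simpa using profile_add_saddleHeight hl i 0

theorem profile_sourceHeight {l : ℕ} (hl : 1 ≤ l) (i : ℕ) : profile l (sourceHeight l i) = 0 := by
  have h := Real.sin_sq_add_cos_sq (Real.pi * ((2 * l - 1) * sourceHeight l i - (l - 1)))
  rw [cos_sourceHeight hl i] at h
  have h0 : Real.sin (Real.pi * ((2 * l - 1) * sourceHeight l i - (l - 1))) = 0 := by
    nlinarith
  rw [profile, h0, mul_zero]

theorem cos_saddleHeight {l : ℕ} (hl : 1 ≤ l) (i : ℕ) :
    Real.cos (Real.pi * ((2 * l - 1) * saddleHeight l i - (l - 1))) = -1 := by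
  have hl' : (1 : ℝ) ≤ l := by exact_mod_cast hl
  have hN : (2 * (l : ℝ) - 1) ≠ 0 := by linarith
  have : Real.pi * ((2 * l - 1) * saddleHeight l i - (l - 1))
      = -Real.pi - i * (2 * Real.pi) := by
    rw [saddleHeight, mul_div_cancel₀ _ hN]; ring
  rw [this, Real.cos_sub_nat_mul_two_pi, Real.cos_neg, Real.cos_pi]

/-- The product of cutoffs that localizes the bifurcation. -/
noncomputable def localizer (l : ℕ) (v : Space) : ℝ :=
  cutoff (v 0) * tightCutoff l (v 1) * cutoff (v 2)

/-- The model field: `2 l - 1` charges and null points on the line `x = -2`, `z = 0`, and the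
saddle-node normal form with parameters `m`, `n` near the origin. -/
noncomputable def model (l : ℕ) (m n : ℝ) (v : Space) : Space :=
  !₂[v 0 + 2 - cutoff (v 0) * (v 0 + 1)
      + localizer l v * ((n - 1) ^ 2 - m * v 0 + n ^ 2 * v 0 ^ 2 - 1),
    v 1 + tightCutoff l (v 1) * (profile l (v 1) - v 1)
      - cutoff (v 0) * tightCutoff l (v 1) * (profile l (v 1) + v 1),
    v 2 * (1 + localizer l v * (m - 2 * n ^ 2 * v 0))]

theorem contDiff_model (l : ℕ) (m n : ℝ) {k : ℕ∞} : ContDiff ℝ k (model l m n) := by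
  have hc := contDiff_cutoff (n := k)
  have ht := contDiff_tightCutoff l (n := k)
  have hp := contDiff_profile l (n := k)
  have hx : ∀ i, ContDiff ℝ k fun v : Space => v i := fun i => by fun_prop
  have c0 := hc.comp (hx 0)
  have c2 := hc.comp (hx 2)
  have t1 := ht.comp (hx 1)
  have p1 := hp.comp (hx 1)
  have hΘ : ContDiff ℝ k (localizer l) := (c0.mul t1).mul c2
  rw [contDiff_euclidean]
  intro i
  fin_cases i
  · exact (((hx 0).add contDiff_const).sub (c0.mul ((hx 0).add contDiff_const))).add
      (hΘ.mul (((contDiff_const.sub (contDiff_const.mul (hx 0))).add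
        (contDiff_const.mul ((hx 0).pow 2))).sub contDiff_const))
  · exact ((hx 1).add (t1.mul (p1.sub (hx 1)))).sub ((c0.mul t1).mul (p1.add (hx 1)))
  · exact (hx 2).mul (contDiff_const.add (hΘ.mul (contDiff_const.sub (contDiff_const.mul (hx 0)))))

theorem localizer_nonneg (l : ℕ) (v : Space) : 0 ≤ localizer l v :=
  mul_nonneg (mul_nonneg (cutoff_nonneg _) (tightCutoff_nonneg _ _)) (cutoff_nonneg _)

theorem localizer_le_one (l : ℕ) (v : Space) : localizer l v ≤ 1 :=
  mul_le_one₀ (mul_le_one₀ (cutoff_le_one _) (tightCutoff_nonneg _ _) (tightCutoff_le_one _ _))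
    (cutoff_nonneg _) (cutoff_le_one _)

theorem tightCutoff_eq_zero_of_le {l : ℕ} {y : ℝ} (h : 3 / 4 ≤ |y|) : tightCutoff l y = 0 := by
  apply tightCutoff_eq_zero
  have : 1 / (4 * ((l : ℝ) + 1)) ≤ 1 / 4 := by
    apply one_div_le_one_div_of_le <;> linarith [Nat.cast_nonneg (α := ℝ) l]
  linarith

theorem localizer_eq_zero_of_notMem {l : ℕ} {v : Space} (hv : v ∉ outerBox) :
    localizer l v = 0 := by
  simp only [outerBox, mem_ofPred_eq, not_and_or, not_lt] at hv
  unfold localizer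
  rcases hv with h | h | h
  · rw [cutoff_eq_zero (by linarith)]; simp
  · rw [tightCutoff_eq_zero_of_le (by linarith)]; simp
  · rw [cutoff_eq_zero (x := v 2) (by linarith)]; simp

theorem model_eq_of_notMem {l : ℕ} {m n m' n' : ℝ} {v : Space} (hv : v ∉ outerBox) :
    model l m n v = model l m' n' v := by
  simp [model, localizer_eq_zero_of_notMem hv]

theorem model_of_box {l : ℕ} {m n : ℝ} {v : Space} (h0 : |v 0| ≤ 1 / 2) (h1 : |v 1| ≤ 1 / 2)
    (h2 : |v 2| ≤ 1 / 2) : model l m n v = !₂[(n - 1) ^ 2 - m * v 0 + n ^ 2 * v 0 ^ 2, -v 1,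
      v 2 * (1 + m - 2 * n ^ 2 * v 0)] := by
  rw [model, localizer, cutoff_eq_one h0, cutoff_eq_one h2, tightCutoff_eq_one h1]
  congr 1
  ext i
  fin_cases i
  · simp only [Fin.zero_eta, Matrix.cons_val]
    ring
  · simp
  · simp only [Fin.reduceFinMk, Matrix.cons_val]
    ring

theorem model_of_left {l : ℕ} {m n : ℝ} {v : Space} (h0 : 3 / 5 ≤ |v 0|) (h1 : |v 1| ≤ 1 / 2) :
    model l m n v = !₂[v 0 + 2, profile l (v 1), v 2] := by
  rw [model, localizer, cutoff_eq_zero h0, tightCutoff_eq_one h1]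
  congr 1
  ext i
  fin_cases i <;> simp

/-! ### Admissible parameters and the zeros of the model -/

/-- The two phases of the saddle-node family. -/
structure Admissible (m n : ℝ) : Prop where
  m_nonneg : 0 ≤ m
  m_le : m ≤ 1 / 3
  n_nonneg : 0 ≤ n
  n_le : n ≤ 1
  eq_or : m = 0 ∨ n = 1

theorem Admissible.abs_le_two {m n : ℝ} (h : Admissible m n) {x : ℝ} (hx : |x| ≤ 3 / 5) :
    |(n - 1) ^ 2 - m * x + n ^ 2 * x ^ 2| ≤ 2 := by
  obtain ⟨h1, h2, h3, h4, -⟩ := h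
  obtain ⟨x1, x2⟩ := abs_le.1 hx
  have a1 : (n - 1) ^ 2 ≤ 1 := by nlinarith
  have a2 : |m * x| ≤ 1 / 3 * (3 / 5) := by
    rw [abs_mul, abs_of_nonneg h1]; gcongr
  have a3 : n ^ 2 * x ^ 2 ≤ 1 * (3 / 5) ^ 2 := by
    apply mul_le_mul (by nlinarith) (by nlinarith) (sq_nonneg _) zero_le_one
  have := abs_le.1 a2
  have := mul_nonneg (sq_nonneg n) (sq_nonneg x)
  have := sq_nonneg (n - 1)
  rw [abs_le]; constructor <;> linarith

/-- For m = 0 the expression is a sum of squares; for n = 1 its minimum is -m²/4, and m ≤ 1/3. The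
small constant keeps the localizer close to 1 at any zero near the origin. -/
theorem Admissible.neg_le {m n : ℝ} (h : Admissible m n) (x : ℝ) :
    -1 / 36 ≤ (n - 1) ^ 2 - m * x + n ^ 2 * x ^ 2 := by
  obtain ⟨h1, h2, h3, h4, rfl | rfl⟩ := h
  · nlinarith [sq_nonneg (n - 1), mul_nonneg (sq_nonneg n) (sq_nonneg x)]
  · nlinarith [sq_nonneg (x - m / 2)]

theorem Admissible.mem_of_nonpos {m n : ℝ} (h : Admissible m n) {x : ℝ}
    (hx : (n - 1) ^ 2 - m * x + n ^ 2 * x ^ 2 ≤ 0) : n = 1 ∧ 0 ≤ x ∧ x ≤ 1 / 3 := by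
  obtain ⟨h1, h2, h3, h4, rfl | rfl⟩ := h
  · have a := sq_nonneg (n - 1)
    have b := mul_nonneg (sq_nonneg n) (sq_nonneg x)
    have c : (n - 1) ^ 2 = 0 := by linarith
    have d : n = 1 := by have := pow_eq_zero_iff (two_ne_zero) |>.1 c; linarith
    subst d
    have e : x ^ 2 = 0 := by nlinarith
    have f : x = 0 := by simpa using e
    subst f
    norm_num
  · refine ⟨rfl, ?_, ?_⟩
    · by_contra hc
      nlinarith
    · by_contra hc
      nlinarith

/-- Away from the x-cutoff the equations decouple and only y needs care. Within it, x' = 0 forces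
the normal form to be nonpositive, hence n = 1 and 0 ≤ x ≤ 1/3; all cutoffs are then near 1, and the
y and z equations leave only the axis. -/
theorem model_eq_zero {l : ℕ} (hl : 1 ≤ l) {m n : ℝ} (h : Admissible m n) {v : Space}
    (hv : model l m n v = 0) :
    (∃ i < l, v = !₂[-2, sourceHeight l i, 0]) ∨ (∃ i < l - 1, v = !₂[-2, saddleHeight l i, 0]) ∨
      ∃ x, v = !₂[x, 0, 0] ∧ 0 ≤ x ∧ x ≤ 1 / 3 ∧ (n - 1) ^ 2 - m * x + n ^ 2 * x ^ 2 = 0 := by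
  have ext3 : ∀ a b c : ℝ, v 0 = a → v 1 = b → v 2 = c → v = !₂[a, b, c] := by
    intro a b c h0 h1 h2
    ext i
    fin_cases i <;> simp [h0, h1, h2]
  have e0 := congrArg (fun w : Space => w 0) hv
  have e1 := congrArg (fun w : Space => w 1) hv
  have e2 := congrArg (fun w : Space => w 2) hv
  simp only [model, PiLp.zero_apply, PiLp.toLp_apply, Matrix.cons_val] at e0 e1 e2
  have c0 := cutoff_nonneg (v 0)
  have c0' := cutoff_le_one (v 0)
  have t0 := tightCutoff_nonneg l (v 1)
  have t0' := tightCutoff_le_one l (v 1)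
  rcases le_or_gt (3 / 5) |v 0| with hx | hx
  · have hz := cutoff_eq_zero hx
    simp only [localizer, hz, zero_mul, sub_zero, add_zero, mul_one] at e0 e1 e2
    have x2 : v 0 = -2 := by linarith
    rcases le_or_gt |v 1| (1 / 2) with hy | hy
    · rw [tightCutoff_eq_one hy] at e1
      rcases exists_of_profile_eq_zero hl hy (by linarith) with ⟨i, hi, h⟩ | ⟨i, hi, h⟩
      · exact .inl ⟨i, hi, ext3 _ _ _ x2 h e2⟩
      · exact .inr (.inl ⟨i, hi, ext3 _ _ _ x2 h e2⟩)
    · exfalso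
      -- Beyond |y| = 1/2 the tight cutoff ends before the next zero of the profile, so y times the
      -- profile is positive on its support and y y' > 0.
      have hp : 0 ≤ tightCutoff l (v 1) * (v 1 * profile l (v 1)) := by
        rcases le_or_gt (1 / 2 + 1 / (4 * ((l : ℝ) + 1))) |v 1| with hy' | hy'
        · rw [tightCutoff_eq_zero hy', zero_mul]
        · refine mul_nonneg t0 ?_
          rcases le_or_gt 0 (v 1) with h0 | h0
          · rw [abs_of_nonneg h0] at hy hy'
            exact mul_nonneg h0 (profile_pos hl hy.le hy').le
          · rw [abs_of_neg h0] at hy hy'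
            have := profile_pos hl hy.le hy'
            rw [profile_neg] at this
            nlinarith
      have hlt : 0 < (1 - tightCutoff l (v 1)) * (v 1) ^ 2
          + tightCutoff l (v 1) * (v 1 * profile l (v 1)) := by
        rcases hp.lt_or_eq with hp' | hp'
        · have := mul_nonneg (sub_nonneg.2 t0') (sq_nonneg (v 1))
          linarith
        · have hy0 : v 1 ≠ 0 := by
            intro h; rw [h] at hy; norm_num at hy
          have hpne : v 1 * profile l (v 1) ≠ 0 ∨ tightCutoff l (v 1) = 0 := by
            rcases le_or_gt (1 / 2 + 1 / (4 * ((l : ℝ) + 1))) |v 1| with hy' | hy'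
            · exact .inr (tightCutoff_eq_zero hy')
            · left
              refine mul_ne_zero hy0 ?_
              rcases le_or_gt 0 (v 1) with h0 | h0
              · rw [abs_of_nonneg h0] at hy hy'
                exact (profile_pos hl hy.le hy').ne'
              · rw [abs_of_neg h0] at hy hy'
                have := profile_pos hl hy.le hy'
                rw [profile_neg] at this
                linarith
          have ht : tightCutoff l (v 1) = 0 := by
            rcases hpne with h | h
            · exact (mul_eq_zero.1 hp'.symm).resolve_right h
            · exact h
          rw [ht]
          have : 0 < v 1 ^ 2 := by positivity
          linarith
      have : (1 - tightCutoff l (v 1)) * (v 1) ^ 2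
          + tightCutoff l (v 1) * (v 1 * profile l (v 1))
          = v 1 * (v 1 + tightCutoff l (v 1) * (profile l (v 1) - v 1)) := by ring
      rw [this, e1, mul_zero] at hlt
      exact lt_irrefl _ hlt
  · right; right
    obtain ⟨x1, x2⟩ := abs_lt.1 hx
    have z0 := cutoff_nonneg (v 2)
    have z0' := cutoff_le_one (v 2)
    set s := (n - 1) ^ 2 - m * v 0 + n ^ 2 * v 0 ^ 2 with hs
    set T := tightCutoff l (v 1) * cutoff (v 2) with hT
    have T0 : 0 ≤ T := mul_nonneg t0 z0
    have Tt : T ≤ tightCutoff l (v 1) := mul_le_of_le_one_right t0 z0'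
    have T1 : T ≤ 1 := Tt.trans t0'
    have hloc : localizer l v = cutoff (v 0) * T := by rw [localizer, hT, mul_assoc]
    rw [hloc] at e0 e2
    -- A convex combination of x + 2 > 0 with a convex combination of 1 and `s`: it can vanish only
    -- if `s` ≤ 0.
    have e0' : (1 - cutoff (v 0)) * (v 0 + 2) + cutoff (v 0) * (1 - T + T * s) = 0 := by
      linarith
    have hslow := h.neg_le (v 0)
    rw [← hs] at hslow
    have hs0 : s ≤ 0 := by
      by_contra hc
      push Not at hc
      have hpos : 0 < 1 - T + T * s := by
        rcases T1.lt_or_eq with h1 | h1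
        · nlinarith
        · rw [h1]; linarith
      rcases c0.lt_or_eq with h1 | h1
      · nlinarith
      · rw [← h1] at e0'; linarith
    obtain ⟨hn, hx0, hx1⟩ := h.mem_of_nonpos (hs ▸ hs0)
    have hc1 : cutoff (v 0) = 1 := cutoff_eq_one (by rw [abs_of_nonneg hx0]; linarith)
    rw [hc1] at e0' e1 e2
    have hTs : T * (1 - s) = 1 := by linarith
    -- From T (1 - s) = 1 and 1 - s ≤ 37/36. Hence the y-cutoff exceeds 1/2, so the factor 1 - 2
    -- `tightCutoff l y` of y' is nonzero.
    have hTlow : 36 / 37 ≤ T := by nlinarith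
    have hm := h.m_nonneg
    have hz : v 2 = 0 := by
      rcases mul_eq_zero.1 e2 with h | h
      · exact h
      · exfalso
        rw [hn] at h
        nlinarith
    have hy : v 1 = 0 := by
      have : v 1 * (1 - 2 * tightCutoff l (v 1)) = 0 := by linarith
      rcases mul_eq_zero.1 this with h | h
      · exact h
      · exfalso; linarith
    have hT1 : T = 1 := by
      rw [hT, hy, hz, tightCutoff_eq_one (by norm_num), cutoff_eq_one (by norm_num), one_mul]
    refine ⟨v 0, ext3 _ _ _ rfl hy hz, hx0, hx1, ?_⟩
    rw [hT1] at hTs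
    linarith

/-! ### The model points outwards from radius 4 on -/

/-- The three coordinates satisfy the same estimate, and the sum is at least ‖v‖²/2 - 6, which is
positive for ‖v‖ ≥ 4. Here x(x + 2) exceeds x²/2 - 2 by (x + 2)²/2, and the remaining part is
bounded where the cutoff lives. -/
theorem model_outward_fst {l : ℕ} {m n : ℝ} (h : Admissible m n) (v : Space) :
    v 0 ^ 2 / 2 - 2 ≤ v 0 * model l m n v 0 := by
  have c0 := cutoff_nonneg (v 0)
  have c0' := cutoff_le_one (v 0)
  have t0 := tightCutoff_nonneg l (v 1)
  have t0' := tightCutoff_le_one l (v 1)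
  have z0 := cutoff_nonneg (v 2)
  have z0' := cutoff_le_one (v 2)
  simp only [model, PiLp.toLp_apply, Matrix.cons_val]
  rcases le_or_gt (3 / 5) |v 0| with hx | hx
  · rw [localizer, cutoff_eq_zero hx]
    nlinarith [sq_nonneg (v 0 + 2)]
  · set s := (n - 1) ^ 2 - m * v 0 + n ^ 2 * v 0 ^ 2 with hs
    set T := tightCutoff l (v 1) * cutoff (v 2) with hT
    have T0 : 0 ≤ T := mul_nonneg t0 z0
    have T1 : T ≤ 1 := (mul_le_of_le_one_right t0 z0').trans t0'
    have hs2 := h.abs_le_two hx.le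
    rw [← hs] at hs2
    have hloc : localizer l v = cutoff (v 0) * T := by rw [localizer, hT, mul_assoc]
    have hb : |1 - T + T * s| ≤ 2 := by
      obtain ⟨s1, s2⟩ := abs_le.1 hs2
      rw [abs_le]; constructor <;> nlinarith
    have hxb : |v 0 * (1 - T + T * s)| ≤ 3 / 5 * 2 := by
      rw [abs_mul]; gcongr
    have hx2 : v 0 ^ 2 ≤ 9 / 25 := by
      obtain ⟨x1, x2⟩ := abs_lt.1 hx
      nlinarith
    have hxl := (abs_le.1 hxb).1
    rw [hloc]
    have : v 0 * (v 0 + 2 - cutoff (v 0) * (v 0 + 1) + cutoff (v 0) * T * (s - 1))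
        = (1 - cutoff (v 0)) * (v 0 ^ 2 + 2 * v 0)
          + cutoff (v 0) * (v 0 * (1 - T + T * s)) := by ring
    rw [this]
    have a1 : (1 - cutoff (v 0)) * (v 0 ^ 2 / 2 - 2)
        ≤ (1 - cutoff (v 0)) * (v 0 ^ 2 + 2 * v 0) := by
      apply mul_le_mul_of_nonneg_left _ (by linarith)
      nlinarith [sq_nonneg (v 0 + 2)]
    have a2 : cutoff (v 0) * (v 0 ^ 2 / 2 - 2) ≤ cutoff (v 0) * (v 0 * (1 - T + T * s)) := by
      apply mul_le_mul_of_nonneg_left _ c0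
      linarith
    linarith

theorem model_outward_snd {l : ℕ} (hl : 1 ≤ l) (m n : ℝ) (v : Space) :
    v 1 ^ 2 / 2 - 2 ≤ v 1 * model l m n v 1 := by
  have c0 := cutoff_nonneg (v 0)
  have c0' := cutoff_le_one (v 0)
  have t0 := tightCutoff_nonneg l (v 1)
  have t0' := tightCutoff_le_one l (v 1)
  simp only [model, PiLp.toLp_apply, Matrix.cons_val]
  rcases le_or_gt (3 / 4) |v 1| with hy | hy
  · rw [tightCutoff_eq_zero_of_le hy]
    nlinarith [sq_nonneg (v 1)]
  · have hp := abs_profile_le hl (v 1)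
    have hyp : |v 1 * profile l (v 1)| ≤ 3 / 4 * 1 := by
      rw [abs_mul]; gcongr
    have hy2 : v 1 ^ 2 ≤ 9 / 16 := by
      obtain ⟨x1, x2⟩ := abs_lt.1 hy
      nlinarith
    have hyl := (abs_le.1 hyp).1
    have : v 1 * (v 1 + tightCutoff l (v 1) * (profile l (v 1) - v 1)
          - cutoff (v 0) * tightCutoff l (v 1) * (profile l (v 1) + v 1))
        = (1 - tightCutoff l (v 1)) * v 1 ^ 2 + tightCutoff l (v 1) *
          ((1 - cutoff (v 0)) * (v 1 * profile l (v 1)) + cutoff (v 0) * -(v 1 ^ 2)) := by ring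
    rw [this]
    have a1 : -1 ≤ (1 - cutoff (v 0)) * (v 1 * profile l (v 1)) + cutoff (v 0) * -(v 1 ^ 2) := by
      nlinarith
    nlinarith [sq_nonneg (v 1)]

theorem model_outward_trd {l : ℕ} {m n : ℝ} (h : Admissible m n) (v : Space) :
    v 2 ^ 2 / 2 - 2 ≤ v 2 * model l m n v 2 := by
  simp only [model, PiLp.toLp_apply, Matrix.cons_val]
  have hL0 := localizer_nonneg l v
  have hL1 := localizer_le_one l v
  by_cases hx : |v 0| < 3 / 5 ∧ |v 2| < 3 / 5
  · obtain ⟨x1, x2⟩ := abs_lt.1 hx.1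
    obtain ⟨y1, y2⟩ := abs_lt.1 hx.2
    have hz2 : v 2 ^ 2 ≤ 9 / 25 := by nlinarith
    have hn2 : n ^ 2 ≤ 1 := by nlinarith [h.n_nonneg, h.n_le]
    have hn0 := sq_nonneg n
    have hm := h.m_nonneg
    have a : -2 ≤ m - 2 * n ^ 2 * v 0 := by
      have hnx : n ^ 2 * v 0 ≤ 1 * 1 :=
        (mul_le_mul_of_nonneg_left (by linarith) hn0).trans
          (mul_le_mul_of_nonneg_right hn2 zero_le_one)
      linarith
    have b : -2 ≤ localizer l v * (m - 2 * n ^ 2 * v 0) := by nlinarith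
    nlinarith [sq_nonneg (v 2)]
  · have : localizer l v = 0 := by
      rw [not_and_or, not_lt, not_lt] at hx
      unfold localizer
      rcases hx with h | h
      · rw [cutoff_eq_zero h]; simp
      · rw [cutoff_eq_zero h]; simp
    rw [this]
    nlinarith [sq_nonneg (v 2)]

theorem inner_model_pos {l : ℕ} (hl : 1 ≤ l) {m n : ℝ} (h : Admissible m n) {v : Space}
    (hv : 4 ≤ ‖v‖) : 0 < inner ℝ (model l m n v) v := by
  have hsq : ‖v‖ ^ 2 = v 0 ^ 2 + v 1 ^ 2 + v 2 ^ 2 := by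
    rw [EuclideanSpace.norm_sq_eq, Fin.sum_univ_three]; simp
  have hin : inner ℝ (model l m n v) v
      = v 0 * model l m n v 0 + v 1 * model l m n v 1 + v 2 * model l m n v 2 := by
    rw [PiLp.inner_apply, Fin.sum_univ_three]; simp
  rw [hin]
  have H0 := model_outward_fst (l := l) h v
  have H1 := model_outward_snd hl m n v
  have H2 := model_outward_trd (l := l) h v
  nlinarith

/-! ### Linearization of the model at its zeros -/

/-- Both local forms of the model, the column and the normal form, are of this kind. -/
theorem exists_hasFDerivAt_of_skew {F : Space → Space} {p : Space} {f g h : ℝ → ℝ} {a b k : ℝ}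
    (hF : F =ᶠ[𝓝 p] fun v => !₂[f (v 0), g (v 1), v 2 * h (v 0)])
    (hf : HasDerivAt f a (p 0)) (hg : HasDerivAt g b (p 1)) (hh : HasDerivAt h k (p 0)) :
    ∃ L : Space →L[ℝ] Space, HasFDerivAt F L p ∧
      ∀ v, L v = !₂[a * v 0, b * v 1, (p 2 * k) * v 0 + h (p 0) * v 2] := by
  have hproj : ∀ i, HasFDerivAt (fun v : Space => v i) (EuclideanSpace.proj (𝕜 := ℝ) i) p :=
    fun i => (EuclideanSpace.proj (𝕜 := ℝ) i : Space →L[ℝ] ℝ).hasFDerivAt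
  let L : Space →L[ℝ] Space := ((EuclideanSpace.equiv (Fin 3) ℝ).symm : (Fin 3 → ℝ) →L[ℝ] Space) ∘L
    ContinuousLinearMap.pi ![a • EuclideanSpace.proj (𝕜 := ℝ) 0, b • EuclideanSpace.proj (𝕜 := ℝ) 1,
      (p 2 * k) • EuclideanSpace.proj (𝕜 := ℝ) 0 + h (p 0) • EuclideanSpace.proj (𝕜 := ℝ) 2]
  have hL : ∀ v, L v = !₂[a * v 0, b * v 1, (p 2 * k) * v 0 + h (p 0) * v 2] := by
    intro v
    ext i
    fin_cases i <;> simp [L]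
  refine ⟨L, HasFDerivAt.congr_of_eventuallyEq ?_ hF, hL⟩
  rw [← hasFDerivWithinAt_univ, hasFDerivWithinAt_euclidean]
  intro i
  rw [hasFDerivWithinAt_univ]
  fin_cases i
  · refine (hf.comp_hasFDerivAt p (hproj 0)).congr_fderiv ?_
    ext v; simp [hL]
  · refine (hg.comp_hasFDerivAt p (hproj 1)).congr_fderiv ?_
    ext v; simp [hL]
  · refine ((hproj 2).mul (hh.comp_hasFDerivAt p (hproj 0))).congr_fderiv ?_
    ext v; simp [hL]; ring

theorem eventually_abs_le {p : Space} {i : Fin 3} {r : ℝ} (h : |p i| < r) :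
    ∀ᶠ v : Space in 𝓝 p, |v i| ≤ r := by
  have hc : Continuous fun v : Space => |v i| := by fun_prop
  exact (hc.continuousAt.eventually (gt_mem_nhds h)).mono fun v hv => le_of_lt hv

theorem eventually_le_abs {p : Space} {i : Fin 3} {r : ℝ} (h : r < |p i|) :
    ∀ᶠ v : Space in 𝓝 p, r ≤ |v i| := by
  have hc : Continuous fun v : Space => |v i| := by fun_prop
  exact (hc.continuousAt.eventually (lt_mem_nhds h)).mono fun v hv => le_of_lt hv

theorem exists_hasFDerivAt_model_of_left {l : ℕ} (hl : 1 ≤ l) (m n : ℝ) {p : Space}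
    (h0 : 3 / 5 < |p 0|) (h1 : |p 1| < 1 / 2) :
    ∃ L : Space →L[ℝ] Space, HasFDerivAt (model l m n) L p ∧ ∀ v, L v = !₂[1 * v 0,
      (2 * Real.cos (Real.pi * ((2 * l - 1) * p 1 - (l - 1)))) * v 1,
      (p 2 * 0) * v 0 + 1 * v 2] := by
  refine exists_hasFDerivAt_of_skew (f := fun x => x + 2) (g := profile l) (h := fun _ => 1) ?_
    ((hasDerivAt_id _).add_const 2) (hasDerivAt_profile hl _) (hasDerivAt_const _ _)
  filter_upwards [eventually_le_abs h0, eventually_abs_le h1] with v hv0 hv1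
  rw [model_of_left hv0 hv1, mul_one]

theorem exists_hasFDerivAt_model_of_box {l : ℕ} (m n : ℝ) {p : Space}
    (h0 : |p 0| < 1 / 2) (h1 : |p 1| < 1 / 2) (h2 : |p 2| < 1 / 2) :
    ∃ L : Space →L[ℝ] Space, HasFDerivAt (model l m n) L p ∧ ∀ v, L v =
      !₂[(-m + 2 * n ^ 2 * p 0) * v 0, (-1) * v 1,
        (p 2 * (-(2 * n ^ 2))) * v 0 + (1 + m - 2 * n ^ 2 * p 0) * v 2] := by
  refine exists_hasFDerivAt_of_skew (f := fun x => (n - 1) ^ 2 - m * x + n ^ 2 * x ^ 2)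
    (g := fun y => -y) (h := fun x => 1 + m - 2 * n ^ 2 * x) ?_ ?_ (hasDerivAt_neg _) ?_
  · filter_upwards [eventually_abs_le h0, eventually_abs_le h1, eventually_abs_le h2]
      with v hv0 hv1 hv2
    rw [model_of_box hv0 hv1 hv2]
  · refine ((((hasDerivAt_id (p 0)).const_mul m).const_sub ((n - 1) ^ 2)).add
      (((hasDerivAt_id (p 0)).pow 2).const_mul (n ^ 2))).congr_deriv ?_
    simp; ring
  · refine (((hasDerivAt_id (p 0)).const_mul (2 * n ^ 2)).const_sub (1 + m)).congr_deriv ?_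
    simp

theorem divergence_model_of_box {l : ℕ} (m n : ℝ) {p : Space} (hp : p ∈ innerBox) :
    divergence (model l m n) p = 0 := by
  obtain ⟨L, h, hL⟩ := exists_hasFDerivAt_model_of_box (l := l) m n hp.1 hp.2.1 hp.2.2
  rw [divergence_of_triangular h hL]
  ring

theorem model_source {l : ℕ} (hl : 1 ≤ l) (m n : ℝ) {i : ℕ} (hi : i < l) :
    model l m n !₂[-2, sourceHeight l i, 0] = 0 := by
  rw [model_of_left (by norm_num) (by simpa using (abs_sourceHeight_lt hi).le)]
  ext j
  fin_cases j <;> simp [profile_sourceHeight hl i]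

theorem model_saddle {l : ℕ} (hl : 1 ≤ l) (m n : ℝ) {i : ℕ} (hi : i < l - 1) :
    model l m n !₂[-2, saddleHeight l i, 0] = 0 := by
  rw [model_of_left (by norm_num) (by simpa using (abs_saddleHeight_lt hi).le)]
  ext j
  fin_cases j <;> simp [profile_saddleHeight hl i]

theorem model_axis {l : ℕ} {m n x : ℝ} (hx : |x| ≤ 1 / 2) :
    model l m n !₂[x, 0, 0] = !₂[(n - 1) ^ 2 - m * x + n ^ 2 * x ^ 2, 0, 0] := by
  rw [model_of_box (by simpa using hx) (by simp) (by simp)]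
  simp

theorem isPositiveCharge_source {l : ℕ} (hl : 1 ≤ l) (m n : ℝ) {i : ℕ} (hi : i < l) :
    IsPositiveCharge (model l m n) !₂[-2, sourceHeight l i, 0] := by
  obtain ⟨L, h, hL⟩ := exists_hasFDerivAt_model_of_left hl m n (p := !₂[-2, sourceHeight l i, 0])
    (by norm_num) (by simpa using abs_sourceHeight_lt hi)
  simp only [Matrix.cons_val, cos_sourceHeight hl i] at hL
  refine ⟨isHyperbolicZero_of_triangular (model_source hl m n hi) h hL (by norm_num) (by norm_num)
    (by norm_num), ?_⟩
  rw [morseIndex_of_triangular h hL]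
  norm_num

/-- The eigenvalues are 1, -2, 1: the slope -2 of the profile is chosen to make the trace vanish. -/
theorem isNegativeNull_saddle {l : ℕ} (hl : 1 ≤ l) (m n : ℝ) {i : ℕ} (hi : i < l - 1) :
    IsNegativeNull (model l m n) !₂[-2, saddleHeight l i, 0] := by
  obtain ⟨L, h, hL⟩ := exists_hasFDerivAt_model_of_left hl m n (p := !₂[-2, saddleHeight l i, 0])
    (by norm_num) (by simpa using abs_saddleHeight_lt hi)
  simp only [Matrix.cons_val, cos_saddleHeight hl i] at hL
  refine ⟨isHyperbolicZero_of_triangular (model_saddle hl m n hi) h hL (by norm_num) (by norm_num)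
    (by norm_num), ?_, ?_⟩
  · rw [morseIndex_of_triangular h hL]
    norm_num
  · rw [divergence_of_triangular h hL]
    norm_num

/-- The eigenvalues are -m, -1, 1 + m. -/
theorem isPositiveNull_zero {l : ℕ} {m : ℝ} (hm : 0 < m) :
    IsPositiveNull (model l m 1) 0 := by
  obtain ⟨L, h, hL⟩ := exists_hasFDerivAt_model_of_box (l := l) m 1 (p := 0)
    (by norm_num) (by norm_num) (by norm_num)
  have h0 : model l m 1 0 = 0 := by
    rw [model_of_box (by simp) (by simp) (by simp)]
    ext j
    fin_cases j <;> simp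
  simp only [PiLp.zero_apply, mul_zero, add_zero, sub_zero] at hL
  refine ⟨isHyperbolicZero_of_triangular h0 h hL (by linarith) (by norm_num) (by linarith), ?_, ?_⟩
  · rw [morseIndex_of_triangular h hL, if_neg (by linarith), if_neg (by norm_num),
      if_pos (by linarith)]
  · rw [divergence_of_triangular h hL]
    ring

/-- The eigenvalues are m, -1, 1 - m. -/
theorem isNegativeNull_axis {l : ℕ} {m : ℝ} (hm : 0 < m) (hm' : m ≤ 1 / 3) :
    IsNegativeNull (model l m 1) !₂[m, 0, 0] := by
  have hmb : |m| < 1 / 2 := by rw [abs_of_pos hm]; linarith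
  obtain ⟨L, h, hL⟩ := exists_hasFDerivAt_model_of_box (l := l) m 1 (p := !₂[m, 0, 0])
    (by simpa using hmb) (by simp) (by simp)
  have h0 : model l m 1 !₂[m, 0, 0] = 0 := by
    rw [model_axis hmb.le]
    ext j
    fin_cases j <;> simp
    ring
  simp only [Matrix.cons_val] at hL
  refine ⟨isHyperbolicZero_of_triangular h0 h hL (by linarith) (by norm_num) (by linarith), ?_, ?_⟩
  · rw [morseIndex_of_triangular h hL, if_pos (by linarith), if_neg (by norm_num),
      if_pos (by linarith)]
  · rw [divergence_of_triangular h hL]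
    ring

/-! ### Counts for the model -/

/-- The sources of the model. -/
def sources (l : ℕ) : Set Space := (fun i => !₂[-2, sourceHeight l i, 0]) '' Iio l

/-- The saddles of the model on the line of the sources. -/
def saddles (l : ℕ) : Set Space := (fun i => !₂[-2, saddleHeight l i, 0]) '' Iio (l - 1)

theorem encard_Iio (l : ℕ) : (Iio l).encard = l := by
  have := Set.encard_coe_eq_coe_finsetCard (Finset.Iio l)
  simpa using this

theorem encard_sources {l : ℕ} (hl : 1 ≤ l) : (sources l).encard = l := by
  have hl' : (1 : ℝ) ≤ l := by exact_mod_cast hl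
  rw [sources, InjOn.encard_image, encard_Iio]
  intro i _ j _ h
  have h1 := congrArg (fun v : Space => v 1) h
  simp only [Matrix.cons_val, sourceHeight] at h1
  rw [div_left_inj' (by linarith)] at h1
  exact_mod_cast (by linarith : (i : ℝ) = j)

theorem encard_saddles {l : ℕ} (hl : 1 ≤ l) : (saddles l).encard = (l - 1 : ℕ) := by
  have hl' : (1 : ℝ) ≤ l := by exact_mod_cast hl
  rw [saddles, InjOn.encard_image, encard_Iio]
  intro i _ j _ h
  have h1 := congrArg (fun v : Space => v 1) h
  simp only [Matrix.cons_val, saddleHeight] at h1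
  rw [div_left_inj' (by linarith)] at h1
  exact_mod_cast (by linarith : (i : ℝ) = j)

theorem encard_insert_saddles {l : ℕ} (hl : 1 ≤ l) {m : ℝ} (hm : 0 < m) :
    (insert !₂[m, 0, 0] (saddles l)).encard = l := by
  rw [encard_insert_of_notMem, encard_saddles hl]
  · exact_mod_cast (by omega : l - 1 + 1 = l)
  · rintro ⟨i, -, h⟩
    have h0 := congrArg (fun v : Space => v 0) h
    simp only [Matrix.cons_val] at h0
    linarith

theorem norm_lt_four {v : Space} (h0 : |v 0| ≤ 2) (h1 : |v 1| ≤ 1) (h2 : |v 2| ≤ 1) :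
    ‖v‖ < 4 := by
  have hsq : ‖v‖ ^ 2 = v 0 ^ 2 + v 1 ^ 2 + v 2 ^ 2 := by
    rw [EuclideanSpace.norm_sq_eq, Fin.sum_univ_three]; simp
  have a0 := sq_le_sq' (abs_le.1 h0).1 (abs_le.1 h0).2
  have a1 := sq_le_sq' (abs_le.1 h1).1 (abs_le.1 h1).2
  have a2 := sq_le_sq' (abs_le.1 h2).1 (abs_le.1 h2).2
  nlinarith [norm_nonneg v]

theorem norm_source_lt {l i : ℕ} (hi : i < l) : ‖(!₂[-2, sourceHeight l i, 0] : Space)‖ < 4 :=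
  norm_lt_four (by norm_num)
    (by have := abs_sourceHeight_lt hi; simp only [Matrix.cons_val]; linarith)
    (by simp)

theorem norm_saddle_lt {l i : ℕ} (hi : i < l - 1) : ‖(!₂[-2, saddleHeight l i, 0] : Space)‖ < 4 :=
  norm_lt_four (by norm_num)
    (by have := abs_saddleHeight_lt hi; simp only [Matrix.cons_val]; linarith)
    (by simp)

theorem norm_axis_lt {m : ℝ} (hm : |m| ≤ 2) : ‖(!₂[m, 0, 0] : Space)‖ < 4 :=
  norm_lt_four (by simpa using hm) (by simp) (by simp)

theorem sources_union_saddles_subset (l : ℕ) :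
    sources l ∪ saddles l ⊆ Metric.closedBall 0 4 := by
  rintro _ (⟨i, hi, rfl⟩ | ⟨i, hi, rfl⟩)
  · exact mem_closedBall_zero_iff.2 (norm_source_lt hi).le
  · exact mem_closedBall_zero_iff.2 (norm_saddle_lt hi).le

theorem model_eq_zero_of_mem {l : ℕ} (hl : 1 ≤ l) (m n : ℝ) {v : Space}
    (hv : v ∈ sources l ∪ saddles l) : model l m n v = 0 := by
  rcases hv with ⟨i, hi, rfl⟩ | ⟨i, hi, rfl⟩
  · exact model_source hl m n hi
  · exact model_saddle hl m n hi

theorem zeros_model {l : ℕ} (hl : 1 ≤ l) {m n : ℝ} (h : Admissible m n) :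
    zeros (model l m n) (Metric.closedBall 0 4) = sources l ∪ saddles l ∪
      {v | ∃ x, v = !₂[x, 0, 0] ∧ 0 ≤ x ∧ x ≤ 1 / 3 ∧
        (n - 1) ^ 2 - m * x + n ^ 2 * x ^ 2 = 0} := by
  ext v
  constructor
  · rintro ⟨-, hv⟩
    rcases model_eq_zero hl h hv with ⟨i, hi, rfl⟩ | ⟨i, hi, rfl⟩ | hx
    · exact .inl (.inl ⟨i, hi, rfl⟩)
    · exact .inl (.inr ⟨i, hi, rfl⟩)
    · exact .inr hx
  · rintro (hv | ⟨x, rfl, h0, h1, hx⟩)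
    · exact ⟨sources_union_saddles_subset l hv, model_eq_zero_of_mem hl m n hv⟩
    · refine ⟨mem_closedBall_zero_iff.2 (norm_axis_lt ?_).le, ?_⟩
      · rw [abs_of_nonneg h0]; linarith
      · rw [model_axis (by rw [abs_of_nonneg h0]; linarith), hx]
        ext j
        fin_cases j <;> simp

theorem zeros_model_of_lt {l : ℕ} (hl : 1 ≤ l) {n : ℝ} (hn : 0 ≤ n) (hn' : n < 1) :
    zeros (model l 0 n) (Metric.closedBall 0 4) = sources l ∪ saddles l := by
  rw [zeros_model hl ⟨le_rfl, by norm_num, hn, hn'.le, .inl rfl⟩, union_eq_left]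
  rintro _ ⟨x, -, -, -, hx⟩
  have : 0 < (n - 1) ^ 2 := by apply sq_pos_of_neg; linarith
  nlinarith [mul_nonneg (sq_nonneg n) (sq_nonneg x)]

theorem vec_zero : (!₂[0, 0, 0] : Space) = 0 := by
  ext j
  fin_cases j <;> simp

/-- The roots of x² - m x. The value m = 0 is included for the bifurcation time, when the two points
coincide. -/
theorem zeros_model_one {l : ℕ} (hl : 1 ≤ l) {m : ℝ} (hm : 0 ≤ m) (hm' : m ≤ 1 / 3) :
    zeros (model l m 1) (Metric.closedBall 0 4)
      = sources l ∪ saddles l ∪ {0, !₂[m, 0, 0]} := by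
  rw [zeros_model hl ⟨hm, hm', zero_le_one, le_rfl, .inr rfl⟩]
  congr 1
  ext v
  constructor
  · rintro ⟨x, rfl, h0, h1, hx⟩
    have : x * (x - m) = 0 := by linarith
    rcases mul_eq_zero.1 this with h | h
    · left; rw [h, vec_zero]
    · right; rw [sub_eq_zero.1 h]; rfl
  · rintro (rfl | rfl)
    · exact ⟨0, vec_zero.symm, le_rfl, by norm_num, by norm_num⟩
    · exact ⟨m, rfl, hm, hm', by ring⟩

theorem hasCounts_model_of_lt {l : ℕ} (hl : 1 ≤ l) {n : ℝ} (hn : 0 ≤ n) (hn' : n < 1) :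
    HasCounts (model l 0 n) (Metric.closedBall 0 4) l (l - 1) 0 := by
  refine hasCounts_of_zeros (S := sources l) (N := saddles l) (P := ∅) ?_ ?_ ?_ ?_ (by simp)
    (encard_sources hl) (encard_saddles hl) (by simp)
  · rw [union_empty]
    exact sources_union_saddles_subset l
  · intro v hv h
    rw [union_empty, ← zeros_model_of_lt hl hn hn']
    exact ⟨hv, h⟩
  · rintro _ ⟨i, hi, rfl⟩
    exact isPositiveCharge_source hl 0 n hi
  · rintro _ ⟨i, hi, rfl⟩
    exact isNegativeNull_saddle hl 0 n hi

theorem isNegativeNull_of_mem {l : ℕ} (hl : 1 ≤ l) {m : ℝ} (hm : 0 < m) (hm' : m ≤ 1 / 3)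
    {v : Space} (hv : v ∈ insert !₂[m, 0, 0] (saddles l)) : IsNegativeNull (model l m 1) v := by
  rcases hv with rfl | ⟨i, hi, rfl⟩
  · exact isNegativeNull_axis hm hm'
  · exact isNegativeNull_saddle hl m 1 hi

theorem hasCounts_model_one {l : ℕ} (hl : 1 ≤ l) {m : ℝ} (hm : 0 < m) (hm' : m ≤ 1 / 3) :
    HasCounts (model l m 1) (Metric.closedBall 0 4) l l 1 := by
  have hset : sources l ∪ insert !₂[m, 0, 0] (saddles l) ∪ {0}
      = zeros (model l m 1) (Metric.closedBall 0 4) := by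
    rw [zeros_model_one hl hm.le hm', insert_eq, insert_eq, union_comm {!₂[m, 0, 0]},
      ← union_assoc, union_assoc, union_comm {!₂[m, 0, 0]}]
  refine hasCounts_of_zeros (S := sources l) (N := insert !₂[m, 0, 0] (saddles l)) (P := {0})
    ?_ ?_ ?_ (fun v hv => isNegativeNull_of_mem hl hm hm' hv) ?_
    (encard_sources hl) (encard_insert_saddles hl hm) (by simp)
  · rw [hset]
    exact fun v hv => hv.1
  · intro v hv h
    rw [hset]
    exact ⟨hv, h⟩
  · rintro _ ⟨i, hi, rfl⟩
    exact isPositiveCharge_source hl m 1 hi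
  · rintro _ rfl
    exact isPositiveNull_zero hm

/-! ### The saddle-node family -/

/-- The family of fields through which the pair of null points is born. -/
noncomputable def birthFamily (l : ℕ) (t : ℝ) : Space → Space := model l (mu t) (nu t)

theorem admissible_mu_nu {t : ℝ} (ht : t ∈ Icc (0 : ℝ) 1) : Admissible (mu t) (nu t) := by
  obtain ⟨h0, h1⟩ := ht
  refine ⟨le_max_right _ _, max_le (by linarith) (by norm_num),
    le_min (by linarith) zero_le_one, min_le_right _ _, ?_⟩
  rcases le_total t (1 / 2) with h | h
  · exact .inl (max_eq_right (by linarith))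
  · exact .inr (min_eq_right (by linarith))

theorem isContinuousFamily_birthFamily (l : ℕ) {R : ℝ} (hR : 0 < R) :
    IsContinuousFamily (birthFamily l) (Metric.closedBall 0 R) := by
  have hB : UniqueDiffOn ℝ (Metric.closedBall (0 : Space) R) := by
    refine uniqueDiffOn_convex (convex_closedBall _ _) ?_
    rw [interior_closedBall _ hR.ne']
    exact ⟨0, Metric.mem_ball_self hR⟩
  have hmu : Continuous mu := by unfold mu; fun_prop
  have hnu : Continuous nu := by unfold nu; fun_prop
  -- The model is affine in m and quadratic in n without mixed terms. The coefficients interpolate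
  -- in n at the nodes 0, 1, -1 (Lagrange), plus m times the difference of the fields at (1, 0) and
  -- (0, 0).
  have := isContinuousFamily_sum_smul (Finset.univ : Finset (Fin 4))
    (a := ![fun t => 1 - mu t - nu t ^ 2, mu, fun t => (nu t ^ 2 + nu t) / 2,
      fun t => (nu t ^ 2 - nu t) / 2])
    (G := ![model l 0 0, model l 1 0, model l 0 1, model l 0 (-1)]) hB
    (fun i _ => by fin_cases i <;> simp <;> fun_prop)
    (fun i _ => by fin_cases i <;> exact (contDiff_model l _ _).contDiffOn)
  convert this using 1
  funext t v
  simp only [Fin.sum_univ_four, Matrix.cons_val, birthFamily]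
  ext j
  fin_cases j
  · simp [model]; ring
  · simp [model]; ring
  · simp [model]; ring

theorem positivelyUnbalanced_birthFamily {l : ℕ} (hl : 1 ≤ l) {t : ℝ} (ht : t ∈ Icc (0 : ℝ) 1) :
    PositivelyUnbalanced (birthFamily l t) 0 4 := by
  refine ⟨by norm_num, (contDiff_model l _ _).contDiffOn, fun x hx => ?_⟩
  rw [sub_zero]
  exact inner_model_pos hl (admissible_mu_nu ht) (mem_sphere_zero_iff_norm.1 hx).ge

theorem outerBox_subset_ball : outerBox ⊆ Metric.ball 0 4 := by
  rintro v ⟨h0, h1, h2⟩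
  exact mem_ball_zero_iff.2 (norm_lt_four (by linarith) (by linarith) h2.le)

theorem isSaddleNodeBirth_birthFamily {l : ℕ} (hl : 1 ≤ l) :
    IsSaddleNodeBirth (birthFamily l) 4 l := by
  have before : ∀ t ∈ Ico (0 : ℝ) (1 / 2), mu t = 0 ∧ 0 ≤ nu t ∧ nu t < 1 := by
    rintro t ⟨h0, h1⟩
    exact ⟨max_eq_right (by linarith), le_min (by linarith) zero_le_one,
      (min_le_left _ _).trans_lt (by linarith)⟩
  have after : ∀ t ∈ Ioc (1 / 2 : ℝ) 1, nu t = 1 ∧ 0 < mu t ∧ mu t ≤ 1 / 3 := by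
    rintro t ⟨h0, h1⟩
    exact ⟨min_eq_right (by linarith), lt_max_of_lt_left (by linarith),
      max_le (by linarith) (by norm_num)⟩
  have zb : ∀ t ∈ Ico (0 : ℝ) (1 / 2),
      zeros (birthFamily l t) (Metric.closedBall 0 4) = sources l ∪ saddles l := by
    intro t ht
    obtain ⟨h1, h2, h3⟩ := before t ht
    rw [birthFamily, h1, zeros_model_of_lt hl h2 h3]
  have z0 := zb 0 ⟨le_rfl, by norm_num⟩
  refine ⟨outerBox_subset_ball, fun t _ x hx => model_eq_of_notMem hx.2, fun t _ x hx => ?_,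
    fun t _ x hx => divergence_model_of_box _ _ hx, fun t ht => ?_, ?_, fun t ht => ?_,
    fun t ht => ?_, fun t ht => ?_, fun t ht => ?_, fun t ht => ?_⟩
  · exact model_of_box hx.1.le hx.2.1.le hx.2.2.le
  · rw [zb t ht, z0]
  · have h1 : mu (1 / 2) = 0 := by norm_num [mu]
    have h2 : nu (1 / 2) = 1 := by norm_num [nu]
    rw [z0, birthFamily, h1, h2, zeros_model_one hl le_rfl (by norm_num), vec_zero, pair_eq_singleton]
  · obtain ⟨h1, h2, h3⟩ := after t ht
    rw [z0, birthFamily, h1, zeros_model_one hl h2.le h3]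
  · obtain ⟨h1, h2, h3⟩ := before t ht
    rw [birthFamily, h1]
    exact hasCounts_model_of_lt hl h2 h3
  · obtain ⟨h1, h2, h3⟩ := after t ht
    rw [birthFamily, h1]
    exact hasCounts_model_one hl h2 h3
  · obtain ⟨h1, h2, h3⟩ := after t ht
    rw [birthFamily, h1]
    exact isPositiveNull_zero h2
  · obtain ⟨h1, h2, h3⟩ := after t ht
    rw [birthFamily, h1]
    exact isNegativeNull_axis h2 h3

/-! ### Lipschitz continuity of the model -/

/-- Bounded Lipschitz functions on space. -/
def IsBoundedLipschitz (f : Space → ℝ) : Prop :=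
  (∃ K : ℝ, ∀ x y, |f x - f y| ≤ K * ‖x - y‖) ∧ ∃ C, ∀ x, |f x| ≤ C

theorem IsBoundedLipschitz.mul {f g : Space → ℝ} (hf : IsBoundedLipschitz f)
    (hg : IsBoundedLipschitz g) : IsBoundedLipschitz fun x => f x * g x := by
  obtain ⟨⟨K, hK⟩, C, hC⟩ := hf
  obtain ⟨⟨K', hK'⟩, C', hC'⟩ := hg
  refine ⟨⟨C * K' + C' * K, fun x y => ?_⟩, C * C', fun x => ?_⟩
  · have : f x * g x - f y * g y = f x * (g x - g y) + g y * (f x - f y) := by ring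
    rw [this, add_mul, mul_assoc, mul_assoc]
    refine (abs_add_le _ _).trans (add_le_add ?_ ?_)
    · rw [abs_mul]
      exact mul_le_mul (hC x) (hK' x y) (abs_nonneg _) ((abs_nonneg _).trans (hC x))
    · rw [abs_mul]
      exact mul_le_mul (hC' y) (hK x y) (abs_nonneg _) ((abs_nonneg _).trans (hC' y))
  · rw [abs_mul]
    exact mul_le_mul (hC x) (hC' x) (abs_nonneg _) ((abs_nonneg _).trans (hC x))

theorem isBoundedLipschitz_comp_coord {f : ℝ → ℝ} (hf : ContDiff ℝ 1 f) (hc : HasCompactSupport f)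
    (i : Fin 3) : IsBoundedLipschitz fun v => f (v i) := by
  obtain ⟨K, hK⟩ := hf.lipschitzWith_of_hasCompactSupport hc one_ne_zero
  obtain ⟨C, hC⟩ := hc.exists_bound_of_continuous hf.continuous
  refine ⟨⟨K, fun x y => ?_⟩, C, fun x => hC _⟩
  have h1 := hK.dist_le_mul (x i) (y i)
  rw [Real.dist_eq, Real.dist_eq] at h1
  refine h1.trans (mul_le_mul_of_nonneg_left ?_ K.2)
  simpa using PiLp.norm_apply_le (x - y) i

theorem norm_le_abs_add_abs_add_abs (v : Space) : ‖v‖ ≤ |v 0| + |v 1| + |v 2| := by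
  have hsq : ‖v‖ ^ 2 = |v 0| ^ 2 + |v 1| ^ 2 + |v 2| ^ 2 := by
    rw [EuclideanSpace.norm_sq_eq, Fin.sum_univ_three]; simp
  have a0 := abs_nonneg (v 0)
  have a1 := abs_nonneg (v 1)
  have a2 := abs_nonneg (v 2)
  refine le_of_sq_le_sq ?_ (by positivity)
  rw [hsq]
  nlinarith [mul_nonneg a0 a1, mul_nonneg a0 a2, mul_nonneg a1 a2]

theorem abs_coord_sub_le (v w : Space) (i : Fin 3) : |v i - w i| ≤ ‖v - w‖ := by
  simpa using PiLp.norm_apply_le (v - w) i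

/-- The common shape of the coordinates of the model: identity, constant, and two bounded Lipschitz
terms. -/
theorem abs_sub_le_of_three {x x' a a' b b' k A B r : ℝ} (h : |x - x'| ≤ r) (ha : |a - a'| ≤ A * r)
    (hb : |b - b'| ≤ B * r) : |(x + k - a + b) - (x' + k - a' + b')| ≤ (1 + A + B) * r := by
  have e : (x + k - a + b) - (x' + k - a' + b') = (x - x') - (a - a') + (b - b') := by ring
  have h1 := abs_add_le ((x - x') - (a - a')) (b - b')
  have h2 := abs_sub (x - x') (a - a')
  rw [e]
  linarith

/-- Each nonlinear factor is grouped with a cutoff in the same variable, giving compactly supported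
functions of one coordinate whose products stay bounded and Lipschitz. -/
theorem exists_lipschitz_model_zero (l : ℕ) (m n : ℝ) :
    ∃ K, ∀ v w, |model l m n v 0 - model l m n w 0| ≤ K * ‖v - w‖ := by
  have hc : ContDiff ℝ 1 cutoff := contDiff_cutoff (n := 1)
  have ht : ContDiff ℝ 1 (tightCutoff l) := contDiff_tightCutoff l (n := 1)
  have sc := hasCompactSupport_cutoff
  have A : IsBoundedLipschitz fun v => cutoff (v 0) * (v 0 + 1) :=
    isBoundedLipschitz_comp_coord (f := fun x => cutoff x * (x + 1)) (by fun_prop) sc.mul_right 0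
  let q : ℝ → ℝ := fun x => cutoff x * ((n - 1) ^ 2 - m * x + n ^ 2 * x ^ 2 - 1)
  have hq : ContDiff ℝ 1 q := by fun_prop
  have sq : HasCompactSupport q := sc.mul_right
  have B := isBoundedLipschitz_comp_coord hq sq 0
  have Y : IsBoundedLipschitz fun v => tightCutoff l (v 1) :=
    isBoundedLipschitz_comp_coord ht (hasCompactSupport_tightCutoff l) 1
  have Z : IsBoundedLipschitz fun v => cutoff (v 2) := isBoundedLipschitz_comp_coord hc sc 2
  obtain ⟨⟨KA, hA⟩, -⟩ := A
  obtain ⟨⟨KB, hB⟩, -⟩ := (B.mul Y).mul Z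
  refine ⟨1 + KA + KB, fun v w => ?_⟩
  have e : ∀ v, model l m n v 0 = v 0 + 2 - cutoff (v 0) * (v 0 + 1)
      + cutoff (v 0) * ((n - 1) ^ 2 - m * v 0 + n ^ 2 * v 0 ^ 2 - 1) * tightCutoff l (v 1)
        * cutoff (v 2) := fun v => by
    simp only [model, localizer, Matrix.cons_val]
    ring
  rw [e, e]
  exact abs_sub_le_of_three (abs_coord_sub_le v w 0) (hA v w) (hB v w)

theorem exists_lipschitz_model_one (l : ℕ) (m n : ℝ) :
    ∃ K, ∀ v w, |model l m n v 1 - model l m n w 1| ≤ K * ‖v - w‖ := by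
  have ht : ContDiff ℝ 1 (tightCutoff l) := contDiff_tightCutoff l (n := 1)
  have hp : ContDiff ℝ 1 (profile l) := contDiff_profile l (n := 1)
  have st := hasCompactSupport_tightCutoff l
  have T : IsBoundedLipschitz fun v => tightCutoff l (v 1) * (v 1 - profile l (v 1)) :=
    isBoundedLipschitz_comp_coord (f := fun y => tightCutoff l y * (y - profile l y))
      (by fun_prop) st.mul_right 1
  have U : IsBoundedLipschitz fun v => tightCutoff l (v 1) * (profile l (v 1) + v 1) :=
    isBoundedLipschitz_comp_coord (f := fun y => tightCutoff l y * (profile l y + y))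
      (by fun_prop) st.mul_right 1
  have X : IsBoundedLipschitz fun v => -cutoff (v 0) :=
    isBoundedLipschitz_comp_coord (contDiff_cutoff (n := 1)).neg
      hasCompactSupport_cutoff.neg 0
  obtain ⟨⟨KT, hT⟩, -⟩ := T
  obtain ⟨⟨KU, hU⟩, -⟩ := X.mul U
  refine ⟨1 + KT + KU, fun v w => ?_⟩
  have e : ∀ v, model l m n v 1 = v 1 + 0 - tightCutoff l (v 1) * (v 1 - profile l (v 1))
      + -cutoff (v 0) * (tightCutoff l (v 1) * (profile l (v 1) + v 1)) := fun v => by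
    simp only [model, Matrix.cons_val]
    ring
  rw [e, e]
  exact abs_sub_le_of_three (abs_coord_sub_le v w 1) (hT v w) (hU v w)

theorem exists_lipschitz_model_two (l : ℕ) (m n : ℝ) :
    ∃ K, ∀ v w, |model l m n v 2 - model l m n w 2| ≤ K * ‖v - w‖ := by
  have hc : ContDiff ℝ 1 cutoff := contDiff_cutoff (n := 1)
  have ht : ContDiff ℝ 1 (tightCutoff l) := contDiff_tightCutoff l (n := 1)
  have sc := hasCompactSupport_cutoff
  let q : ℝ → ℝ := fun x => cutoff x * (m - 2 * n ^ 2 * x)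
  have hq : ContDiff ℝ 1 q := by fun_prop
  have sq : HasCompactSupport q := sc.mul_right
  have C := isBoundedLipschitz_comp_coord hq sq 0
  have Y : IsBoundedLipschitz fun v => tightCutoff l (v 1) :=
    isBoundedLipschitz_comp_coord ht (hasCompactSupport_tightCutoff l) 1
  have E : IsBoundedLipschitz fun v => cutoff (v 2) * v 2 :=
    isBoundedLipschitz_comp_coord (f := fun z => cutoff z * z) (by fun_prop) sc.mul_right 2
  obtain ⟨⟨KC, hC⟩, -⟩ := (C.mul Y).mul E
  refine ⟨1 + 0 + KC, fun v w => ?_⟩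
  have e : ∀ v, model l m n v 2 = v 2 + 0 - 0
      + cutoff (v 0) * (m - 2 * n ^ 2 * v 0) * tightCutoff l (v 1) * (cutoff (v 2) * v 2) :=
    fun v => by
      simp only [model, localizer, Matrix.cons_val]
      ring
  rw [e, e]
  exact abs_sub_le_of_three (abs_coord_sub_le v w 2) (by simp) (hC v w)

theorem exists_lipschitzWith_model (l : ℕ) (m n : ℝ) : ∃ K, LipschitzWith K (model l m n) := by
  obtain ⟨K₀, h₀⟩ := exists_lipschitz_model_zero l m n
  obtain ⟨K₁, h₁⟩ := exists_lipschitz_model_one l m n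
  obtain ⟨K₂, h₂⟩ := exists_lipschitz_model_two l m n
  refine ⟨Real.toNNReal (K₀ + K₁ + K₂), LipschitzWith.of_dist_le_mul fun v w => ?_⟩
  rw [dist_eq_norm, dist_eq_norm]
  refine le_trans ?_ (mul_le_mul_of_nonneg_right (Real.le_coe_toNNReal _) (norm_nonneg _))
  refine (norm_le_abs_add_abs_add_abs _).trans ?_
  simp only [PiLp.sub_apply]
  linarith [h₀ v w, h₁ v w, h₂ v w]

/-! ### The field after the bifurcation and its orbits -/

/-- The model field at the end of the saddle-node family. -/
noncomputable abbrev finalModel (l : ℕ) : Space → Space := model l (1 / 3) 1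

/-- Complete field lines of the final model. -/
def IsOrbit (l : ℕ) (u : ℝ → Space) : Prop := ∀ s, HasDerivAt u (finalModel l (u s)) s

theorem exists_isOrbit (l : ℕ) (v : Space) : ∃ u, u 0 = v ∧ IsOrbit l u := by
  obtain ⟨K, hK⟩ := exists_lipschitzWith_model l (1 / 3) 1
  exact exists_forall_hasDerivAt_of_lipschitzWith hK (contDiff_model l _ _ (k := 1)) v

theorem IsOrbit.eq {l : ℕ} {u w : ℝ → Space} (hu : IsOrbit l u) (hw : IsOrbit l w) {s : ℝ}
    (h : u s = w s) : u = w := by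
  obtain ⟨K, hK⟩ := exists_lipschitzWith_model l (1 / 3) 1
  exact eq_of_hasDerivAt_of_eq hK hu hw h

theorem IsOrbit.comp_add {l : ℕ} {u : ℝ → Space} (hu : IsOrbit l u) (τ : ℝ) :
    IsOrbit l fun s => u (s + τ) := fun s => (hu (s + τ)).comp_add_const s τ

theorem IsOrbit.exists_shift {l : ℕ} {u w : ℝ → Space} (hu : IsOrbit l u) (hw : IsOrbit l w)
    {a b : ℝ} (h : u a = w b) : ∃ τ, ∀ s, u s = w (s + τ) :=
  ⟨b - a, congrFun (hu.eq (hw.comp_add (b - a)) (s := a) (by simpa using h))⟩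

theorem hasDerivAt_coord {u : ℝ → Space} {u' : Space} {s : ℝ} (h : HasDerivAt u u' s) (i : Fin 3) :
    HasDerivAt (fun s => u s i) (u' i) s := by
  have hp : HasFDerivAt (fun v : Space => v i) (EuclideanSpace.proj (𝕜 := ℝ) i) (u s) :=
    (EuclideanSpace.proj (𝕜 := ℝ) i : Space →L[ℝ] ℝ).hasFDerivAt
  exact hp.comp_hasDerivAt s h

theorem hasDerivAt_vec {f g h : ℝ → ℝ} {a b c s : ℝ} (hf : HasDerivAt f a s)
    (hg : HasDerivAt g b s) (hh : HasDerivAt h c s) :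
    HasDerivAt (fun s => (!₂[f s, g s, h s] : Space)) !₂[a, b, c] s := by
  have : HasDerivAt (fun s => (![f s, g s, h s] : Fin 3 → ℝ)) ![a, b, c] s := by
    rw [hasDerivAt_pi]
    intro i
    fin_cases i
    · exact hf
    · exact hg
    · exact hh
  exact ((EuclideanSpace.equiv (Fin 3) ℝ).symm : (Fin 3 → ℝ) →L[ℝ] Space).hasFDerivAt.comp_hasDerivAt
    s this

theorem tendsto_of_coord {α : Type*} {f : Filter α} {u : α → Space} {p : Space}
    (h : ∀ i, Tendsto (fun a => u a i) f (𝓝 (p i))) : Tendsto u f (𝓝 p) :=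
  ((PiLp.continuous_toLp 2 fun _ : Fin 3 => ℝ).tendsto p.ofLp).comp (tendsto_pi_nhds.2 h)

theorem tendsto_coord {α : Type*} {f : Filter α} {u : α → Space} {p : Space}
    (h : Tendsto u f (𝓝 p)) (i : Fin 3) : Tendsto (fun a => u a i) f (𝓝 (p i)) :=
  ((by fun_prop : Continuous fun v : Space => v i).tendsto p).comp h

/-- The expansion rate transverse to the plane `z = 0`. -/
noncomputable def rate (l : ℕ) (v : Space) : ℝ := 1 + localizer l v * (1 / 3 - 2 * v 0)

theorem finalModel_two (l : ℕ) (v : Space) : finalModel l v 2 = v 2 * rate l v := by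
  simp [model, rate]

/-- The localizer lives on |x| < 3/5, where 1/3 - 2x lies between -13/15 and 23/15. The lower bound
makes the plane z = 0 repelling everywhere. -/
theorem rate_mem (l : ℕ) (v : Space) : 1 / 10 ≤ rate l v ∧ rate l v ≤ 3 := by
  unfold rate
  have h0 := localizer_nonneg l v
  have h1 := localizer_le_one l v
  rcases le_or_gt (3 / 5) |v 0| with h | h
  · have : localizer l v = 0 := by rw [localizer, cutoff_eq_zero h]; simp
    rw [this]; norm_num
  · obtain ⟨a, b⟩ := abs_lt.1 h
    constructor <;> nlinarith

theorem IsOrbit.two_eq_zero_of_le {l : ℕ} {u : ℝ → Space} (hu : IsOrbit l u) {a : ℝ}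
    (ha : u a 2 = 0) : ∀ s, a ≤ s → u s 2 = 0 := by
  intro s hs
  refine eq_zero_of_abs_deriv_le_mul_abs_self_of_eq_zero_right (K := 3) (b := s)
    (f := fun s => u s 2) (f' := fun s => finalModel l (u s) 2)
    (fun x _ => (hasDerivAt_coord (hu x) 2).continuousAt.continuousWithinAt)
    (fun x _ => (hasDerivAt_coord (hu x) 2).hasDerivWithinAt) ha (fun x _ => ?_) s
    (right_mem_Icc.2 hs)
  have := rate_mem l (u x)
  rw [finalModel_two, norm_mul, mul_comm]
  gcongr
  rw [Real.norm_eq_abs, abs_of_nonneg (by linarith)]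
  exact this.2

/-- Along an orbit z² is nondecreasing, so it is bounded by its limit 0. Thus all separators are
planar. -/
theorem IsOrbit.two_eq_zero_of_tendsto {l : ℕ} {u : ℝ → Space} (hu : IsOrbit l u)
    (h : Tendsto u atTop (𝓝 0)) (s : ℝ) : u s 2 = 0 := by
  have hd : ∀ s, HasDerivAt (fun s => u s 2 ^ 2) (2 * u s 2 * (u s 2 * rate l (u s))) s := by
    intro s
    have := (hasDerivAt_coord (hu s) 2).pow 2
    rw [finalModel_two] at this
    exact this.congr_deriv (by simp)
  have hm : Monotone fun s => u s 2 ^ 2 := by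
    refine monotone_of_deriv_nonneg (fun s => (hd s).differentiableAt) fun s => ?_
    rw [(hd s).deriv]
    have := (rate_mem l (u s)).1
    nlinarith [mul_nonneg (sq_nonneg (u s 2)) (by linarith : 0 ≤ rate l (u s))]
  have hl : Tendsto (fun s => u s 2 ^ 2) atTop (𝓝 0) := by
    simpa using (tendsto_coord h 2).pow 2
  have := hm.ge_of_tendsto hl s
  nlinarith

/-- The planar field in the strip `|y| ≤ 1/2`. -/
theorem finalModel_of_strip {l : ℕ} {v : Space} (h1 : |v 1| ≤ 1 / 2) (h2 : v 2 = 0) :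
    finalModel l v 0 = (1 - cutoff (v 0)) * (v 0 + 2) + cutoff (v 0) * (v 0 * (v 0 - 1 / 3)) ∧
    finalModel l v 1 = (1 - cutoff (v 0)) * profile l (v 1) - cutoff (v 0) * v 1 := by
  simp only [model, localizer, tightCutoff_eq_one h1, h2, cutoff_eq_one (x := 0) (by norm_num),
    Matrix.cons_val]
  constructor <;> ring

theorem tendsto_zero_of_sq {f : ℝ → ℝ} {F : Filter ℝ} (h : Tendsto (fun s => f s ^ 2) F (𝓝 0)) :
    Tendsto f F (𝓝 0) := by
  rw [tendsto_zero_iff_abs_tendsto_zero]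
  have := h.sqrt
  simpa [Real.sqrt_sq_eq_abs, Function.comp_def] using this

/-- Forward invariance of the strip bounded by a height where the profile is negative. -/
theorem IsOrbit.abs_one_le {l : ℕ} {u : ℝ → Space} (hu : IsOrbit l u) {Y : ℝ} (hY0 : 0 < Y)
    (hY : Y ≤ 1 / 2) (hp : profile l Y < 0) {a : ℝ} (h2 : u a 2 = 0) (h1 : |u a 1| ≤ Y) :
    ∀ s, a ≤ s → |u s 1| ≤ Y := by
  have hz := hu.two_eq_zero_of_le h2
  -- This is the inward speed at the edges y = ±Y; by oddness of the profile it serves both.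
  have key : ∀ s, a ≤ s → 0 < (1 - cutoff (u s 0)) * (-profile l Y) + cutoff (u s 0) * Y := by
    intro s _
    have c0 := cutoff_nonneg (u s 0)
    have c1 := cutoff_le_one (u s 0)
    rcases c0.lt_or_eq with h | h
    · nlinarith
    · rw [← h]; linarith
  obtain ⟨ha, hb⟩ := abs_le.1 h1
  intro s hs
  rw [abs_le]
  constructor
  · refine le_of_deriv_pos_of_eq (fun s _ => hasDerivAt_coord (hu s) 1) ha (fun s hs e => ?_) s hs
    have e' : u s 1 = -Y := e
    rw [(finalModel_of_strip (by rw [e', abs_neg, abs_of_pos hY0]; exact hY) (hz s hs)).2, e',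
      profile_neg]
    linarith [key s hs]
  · refine le_of_deriv_neg_of_eq (fun s _ => hasDerivAt_coord (hu s) 1) hb (fun s hs e => ?_) s hs
    have e' : u s 1 = Y := e
    rw [(finalModel_of_strip (by rw [e', abs_of_pos hY0]; exact hY) (hz s hs)).2, e']
    linarith [key s hs]

/-- Forward orbits in the strip to the right of the sources and to the left of the null point
`(1/3, 0, 0)` converge to the origin. -/
theorem IsOrbit.forward {l : ℕ} {u : ℝ → Space} (hu : IsOrbit l u) {Y : ℝ} (hY0 : 0 < Y)
    (hY : Y ≤ 1 / 2) (hp : profile l Y < 0) {a : ℝ} (h2 : u a 2 = 0) (h1 : |u a 1| ≤ Y)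
    (h0 : -2 < u a 0) (h0' : u a 0 < 1 / 3) :
    (∀ s, a ≤ s → -2 < u s 0 ∧ u s 0 < 1 / 3 ∧ |u s 1| ≤ Y ∧ u s 2 = 0) ∧
      Tendsto u atTop (𝓝 0) := by
  have hz := hu.two_eq_zero_of_le h2
  have hy := hu.abs_one_le hY0 hY hp h2 h1
  have hf : ∀ s, a ≤ s → finalModel l (u s) 0
      = (1 - cutoff (u s 0)) * (u s 0 + 2) + cutoff (u s 0) * (u s 0 * (u s 0 - 1 / 3)) :=
    fun s hs => (finalModel_of_strip ((hy s hs).trans hY) (hz s hs)).1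
  have hd : ∀ i s, HasDerivAt (fun s => u s i) (finalModel l (u s) i) s :=
    fun i s => hasDerivAt_coord (hu s) i
  -- Barriers in (-2, 0) and (0, 1/3): the flow crosses x = x₀ to the right and x = x₁ to the left,
  -- so x stays a fixed distance from -2 and 1/3 and contracts at a uniform rate.
  set x₀ := min (u a 0) (-1 / 4)
  set x₁ := max (u a 0) (1 / 4)
  have b0 : -2 < x₀ := lt_min h0 (by norm_num)
  have b0' : x₀ < 0 := (min_le_right _ _).trans_lt (by norm_num)
  have b1 : x₁ < 1 / 3 := max_lt h0' (by norm_num)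
  have b1' : 0 < x₁ := lt_max_of_lt_right (by norm_num)
  have low : ∀ s, a ≤ s → x₀ ≤ u s 0 := by
    refine le_of_deriv_pos_of_eq (fun s _ => hd 0 s) (min_le_left _ _) fun s hs e => ?_
    have e' : u s 0 = x₀ := e
    rw [hf s hs, e']
    have c0 := cutoff_nonneg x₀
    have c1 := cutoff_le_one x₀
    have : 0 < x₀ * (x₀ - 1 / 3) := mul_pos_of_neg_of_neg b0' (by linarith)
    rcases c0.lt_or_eq with h | h
    · nlinarith [mul_pos h this]
    · rw [← h]; linarith
  have high : ∀ s, a ≤ s → u s 0 ≤ x₁ := by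
    refine le_of_deriv_neg_of_eq (fun s _ => hd 0 s) (le_max_left _ _) fun s hs e => ?_
    have e' : u s 0 = x₁ := e
    rw [hf s hs, e', cutoff_eq_one (by rw [abs_of_pos b1']; linarith)]
    nlinarith
  refine ⟨fun s hs => ⟨b0.trans_le (low s hs), (high s hs).trans_lt b1, hy s hs, hz s hs⟩, ?_⟩
  -- The three bounds serve x' = x + 2 for x ≤ 0, x' = x(x - 1/3) for x ≤ 0, and the latter for x >
  -- 0.
  obtain ⟨k, hk, hk1, hk2, hk3⟩ : ∃ k : ℝ, 0 < k ∧ k ≤ (x₀ + 2) / 2 ∧ k ≤ 1 / 3 ∧ k ≤ 1 / 3 - x₁ :=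
    ⟨min ((x₀ + 2) / 2) (min (1 / 3) (1 / 3 - x₁)),
      lt_min (by linarith) (lt_min (by norm_num) (by linarith)), min_le_left _ _,
      (min_le_right _ _).trans (min_le_left _ _), (min_le_right _ _).trans (min_le_right _ _)⟩
  have contract : ∀ s, a ≤ s → u s 0 * finalModel l (u s) 0 ≤ -k * u s 0 ^ 2 := by
    intro s hs
    rw [hf s hs]
    have l0 := low s hs
    have l1 := high s hs
    have c0 := cutoff_nonneg (u s 0)
    have c1 := cutoff_le_one (u s 0)
    set x := u s 0
    rcases le_or_gt x 0 with h | h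
    · have e1 : x * (x + 2) ≤ -k * x ^ 2 := by
        have h1 : k * -x ≤ k * 2 := mul_le_mul_of_nonneg_left (by linarith) hk.le
        have h2 : 0 ≤ x + 2 + k * x := by linarith
        nlinarith [mul_nonneg_of_nonpos_of_nonpos h (neg_nonpos.2 h2)]
      have e2 : x * (x * (x - 1 / 3)) ≤ -k * x ^ 2 := by nlinarith [sq_nonneg x]
      nlinarith
    · have : cutoff x = 1 := cutoff_eq_one (by rw [abs_of_pos h]; linarith)
      rw [this]
      nlinarith [sq_nonneg x]
  have tx : Tendsto (fun s => u s 0) atTop (𝓝 0) := by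
    refine tendsto_zero_of_sq (tendsto_zero_of_deriv_le (a := a) (k := 2 * k) (by linarith)
      (fun s _ => (hd 0 s).pow 2) (fun s _ => sq_nonneg _) fun s hs => ?_)
    have := contract s hs
    simp only [Nat.cast_ofNat, Nat.add_one_sub_one, pow_one]
    linarith
  -- The profile has zeros inside the strip, so y need not decay at once; it does so once |x| ≤ 1/2,
  -- where y' = -y.
  have ty : Tendsto (fun s => u s 1) atTop (𝓝 0) := by
    obtain ⟨b, hb⟩ := eventually_atTop.1 (tx.eventually (Metric.closedBall_mem_nhds (0 : ℝ)
      (by norm_num : (0 : ℝ) < 1 / 2)))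
    refine tendsto_zero_of_sq (tendsto_zero_of_deriv_le (a := max a b) (k := 2) (by norm_num)
      (fun s _ => (hd 1 s).pow 2) (fun s _ => sq_nonneg _) fun s hs => ?_)
    have hs1 : a ≤ s := (le_max_left _ _).trans hs
    have hs2 := hb s ((le_max_right _ _).trans hs)
    rw [(finalModel_of_strip ((hy s hs1).trans hY) (hz s hs1)).2,
      cutoff_eq_one (by simpa using hs2)]
    simp only [Nat.cast_ofNat, Nat.add_one_sub_one, pow_one]
    linarith
  have tz : Tendsto (fun s => u s 2) atTop (𝓝 0) := by
    refine tendsto_const_nhds.congr' ?_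
    filter_upwards [eventually_ge_atTop a] with s hs
    exact (hz s hs).symm
  refine tendsto_of_coord fun i => ?_
  fin_cases i
  · exact tx
  · exact ty
  · exact tz

/-! ### Separatrices of the negative null points -/

/-- A height between the outermost saddle and the outermost source. -/
noncomputable def innerHeight (l : ℕ) : ℝ := (l - 3 / 2) / (2 * l - 1)

/-- A second height between the outermost saddle and the outermost source. -/
noncomputable def outerHeight (l : ℕ) : ℝ := (l - 5 / 4) / (2 * l - 1)

theorem heights {l : ℕ} (hl : 2 ≤ l) : 0 < innerHeight l ∧ innerHeight l < outerHeight l ∧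
    outerHeight l ≤ 1 / 2 ∧ profile l (innerHeight l) < 0 ∧ profile l (outerHeight l) < 0 := by
  have hl' : (2 : ℝ) ≤ l := by exact_mod_cast hl
  have hN : 0 < 2 * (l : ℝ) - 1 := by linarith
  have e1 : (2 * (l : ℝ) - 1) * innerHeight l = l - 3 / 2 := mul_div_cancel₀ _ hN.ne'
  have e2 : (2 * (l : ℝ) - 1) * outerHeight l = l - 5 / 4 := mul_div_cancel₀ _ hN.ne'
  refine ⟨div_pos (by linarith) hN, ?_, ?_, ?_, ?_⟩
  · exact div_lt_div_of_pos_right (by linarith) hN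
  · rw [outerHeight, div_le_iff₀ hN]; linarith
  · exact profile_neg_of_mem (by omega) (by linarith) (by linarith)
  · exact profile_neg_of_mem (by omega) (by linarith) (by linarith)

theorem abs_saddleHeight_le_innerHeight {l i : ℕ} (hi : i < l - 1) :
    |saddleHeight l i| ≤ innerHeight l := by
  refine (abs_saddleHeight_le hi).trans ?_
  have h : 1 ≤ l := by omega
  have hl' : (1 : ℝ) ≤ l := by exact_mod_cast h
  exact div_le_div_of_nonneg_right (by linarith) (by linarith)

/-- A planar neighbourhood of the separators in the basin of the origin. -/
def planarBasin (l : ℕ) : Set Space :=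
  {v | -2 < v 0 ∧ v 0 < 1 / 3 ∧ |v 1| < outerHeight l ∧ v 2 = 0}

/-- To the left of the cutoff, x' = x + 2 and the height of a saddle is invariant. The sign of `c`
is free: positive for the separatrix, nonpositive for the saddle itself and the branch that escapes.
-/
theorem hasDerivAt_left_ray {l : ℕ} (hl : 1 ≤ l) {i : ℕ} (hi : i < l - 1) {c s : ℝ}
    (h : -2 + c * Real.exp s ≤ -3 / 5) :
    HasDerivAt (fun s => (!₂[-2 + c * Real.exp s, saddleHeight l i, 0] : Space))
      (finalModel l !₂[-2 + c * Real.exp s, saddleHeight l i, 0]) s := by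
  have e : finalModel l !₂[-2 + c * Real.exp s, saddleHeight l i, 0]
      = !₂[-2 + c * Real.exp s + 2, profile l (saddleHeight l i), 0] := by
    refine model_of_left ?_ (by simpa using (abs_saddleHeight_lt hi).le)
    simp only [Matrix.cons_val]
    rw [abs_of_neg (by linarith)]
    linarith
  rw [e, profile_saddleHeight hl i, neg_add_cancel_comm]
  exact hasDerivAt_vec (((Real.hasDerivAt_exp s).const_mul c).const_add (-2))
    (hasDerivAt_const s (saddleHeight l i)) (hasDerivAt_const s (0 : ℝ))

theorem exists_separatrix_saddle {l : ℕ} (hl : 2 ≤ l) {i : ℕ} (hi : i < l - 1) :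
    ∃ γ, IsOrbit l γ ∧ (∀ s, γ s ∈ planarBasin l) ∧
      Tendsto γ atBot (𝓝 !₂[-2, saddleHeight l i, 0]) ∧ Tendsto γ atTop (𝓝 0) ∧
      ∀ s ≤ 0, γ s = !₂[-2 + 1 / 8 * Real.exp s, saddleHeight l i, 0] := by
  obtain ⟨h1, h2, h3, h4, h5⟩ := heights hl
  have hi' := abs_saddleHeight_le_innerHeight hi
  obtain ⟨γ, hγ0, hγ⟩ := exists_isOrbit l !₂[-2 + 1 / 8, saddleHeight l i, 0]
  have hexp : ∀ s ≤ 0, -2 + 1 / 8 * Real.exp s ≤ -3 / 5 := fun s hs => by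
    have := Real.exp_le_one_iff.2 hs
    linarith
  have hray : ∀ s ≤ 0, γ s = !₂[-2 + 1 / 8 * Real.exp s, saddleHeight l i, 0] := by
    intro s hs
    obtain ⟨K, hK⟩ := exists_lipschitzWith_model l (1 / 3) 1
    refine ODE_solution_unique_of_mem_Icc_left (v := fun _ => finalModel l) (s := fun _ => univ)
      (a := s) (b := 0) (g := fun s => !₂[-2 + 1 / 8 * Real.exp s, saddleHeight l i, 0])
      (fun t _ => hK.lipschitzOnWith) (fun t _ => (hγ t).continuousAt.continuousWithinAt)
      (fun t _ => (hγ t).hasDerivWithinAt) (fun _ _ => trivial) (fun t ht => ?_) (fun t ht => ?_)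
      (fun _ _ => trivial) ?_ (left_mem_Icc.2 hs)
    · exact (hasDerivAt_left_ray (by omega) hi (hexp t ht.2)).continuousAt.continuousWithinAt
    · exact (hasDerivAt_left_ray (by omega) hi (hexp t ht.2)).hasDerivWithinAt
    · rw [hγ0]; simp
  -- The strip of the lower height is used, so that the orbit lies strictly inside `planarBasin`,
  -- which is bounded by the upper one.
  obtain ⟨hf, hlim⟩ := hγ.forward h1 (h2.le.trans h3) h4 (a := 0) (by rw [hγ0]; simp)
    (by rw [hγ0]; simpa using hi') (by rw [hγ0]; simp only [Matrix.cons_val]; norm_num)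
    (by rw [hγ0]; simp only [Matrix.cons_val]; norm_num)
  refine ⟨γ, hγ, fun s => ?_, ?_, hlim, hray⟩
  · rcases le_total 0 s with hs | hs
    · obtain ⟨a, b, c, d⟩ := hf s hs
      exact ⟨a, b, c.trans_lt h2, d⟩
    · rw [hray s hs]
      have := hexp s hs
      have := Real.exp_pos s
      exact ⟨by simp only [Matrix.cons_val]; linarith, by simp only [Matrix.cons_val]; linarith,
        by simpa using hi'.trans_lt h2, by simp⟩
  · have : Tendsto (fun s => (!₂[-2 + 1 / 8 * Real.exp s, saddleHeight l i, 0] : Space)) atBot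
        (𝓝 !₂[-2, saddleHeight l i, 0]) := by
      refine tendsto_of_coord fun j => ?_
      fin_cases j
      · simpa using (Real.tendsto_exp_atBot.const_mul (8⁻¹ : ℝ)).const_add (-2)
      · exact tendsto_const_nhds
      · exact tendsto_const_nhds
    refine this.congr' ?_
    filter_upwards [eventually_le_atBot 0] with s hs
    exact (hray s hs).symm

theorem eventually_abs_sub_lt {u : ℝ → Space} {F : Filter ℝ} {p : Space} (h : Tendsto u F (𝓝 p))
    (i : Fin 3) {r : ℝ} (hr : 0 < r) : ∀ᶠ s in F, |u s i - p i| < r := by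
  have := (tendsto_coord h i).eventually (Metric.ball_mem_nhds _ hr)
  simpa [Real.dist_eq] using this

theorem vec_ext {v : Space} {a b c : ℝ} (h0 : v 0 = a) (h1 : v 1 = b) (h2 : v 2 = c) :
    v = !₂[a, b, c] := by
  ext i
  fin_cases i <;> simp [h0, h1, h2]

/-- In the plane the saddle attracts in y, so near time -∞ the orbit cannot leave the line y = h.
There x = -2 + C exp s, and C > 0 because the orbit reaches the origin. -/
theorem exists_shift_saddle {l : ℕ} (hl : 2 ≤ l) {i : ℕ} (hi : i < l - 1) {γ u : ℝ → Space}
    (hγ : IsOrbit l γ) (hray : ∀ s ≤ 0, γ s = !₂[-2 + 1 / 8 * Real.exp s, saddleHeight l i, 0])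
    (hu : IsOrbit l u) (hbot : Tendsto u atBot (𝓝 !₂[-2, saddleHeight l i, 0]))
    (htop : Tendsto u atTop (𝓝 0)) : ∃ τ, ∀ s, u s = γ (s + τ) := by
  have hl' : (2 : ℝ) ≤ l := by exact_mod_cast hl
  have hN : 0 < 2 * (l : ℝ) - 1 := by linarith
  have hz := hu.two_eq_zero_of_tendsto htop
  have hi' := abs_saddleHeight_lt hi
  set h := saddleHeight l i with hh
  -- Tolerance 1 keeps x < -1, outside the cutoff; 1 / (2l - 1) is half a period of the profile, so
  -- its sign is known; 1/2 - |h| keeps |y| < 1/2.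
  obtain ⟨a, ha⟩ := eventually_atBot.1 ((eventually_abs_sub_lt hbot 0 one_pos).and
    ((eventually_abs_sub_lt hbot 1 (one_div_pos.2 hN)).and
      (eventually_abs_sub_lt hbot 1 (sub_pos.2 hi'))))
  simp only [Matrix.cons_val] at ha
  have hloc : ∀ s ≤ a, finalModel l (u s) = !₂[u s 0 + 2, profile l (u s 1), u s 2] := by
    intro s hs
    obtain ⟨h0, -, h1⟩ := ha s hs
    refine model_of_left ?_ ?_
    · obtain ⟨b, c⟩ := abs_lt.1 h0
      rw [abs_of_neg (by linarith)]
      linarith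
    · have := abs_sub_abs_le_abs_sub (u s 1) h
      linarith
  have hy : ∀ s ≤ a, u s 1 = h := by
    have hd : ∀ s ≤ a, HasDerivAt (fun s => (u s 1 - h) ^ 2)
        (2 * (u s 1 - h) * profile l (u s 1)) s := fun s hs => by
      have := ((hasDerivAt_coord (hu s) 1).sub_const h).pow 2
      rw [hloc s hs] at this
      exact this.congr_deriv (by simp)
    have hlim : Tendsto (fun s => (u s 1 - h) ^ 2) atBot (𝓝 0) := by
      simpa using ((tendsto_coord hbot 1).sub_const h).pow 2
    intro s hs
    have := eq_zero_of_deriv_nonpos_of_tendsto_atBot hd (fun s _ => sq_nonneg _) (fun s hs => ?_)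
      hlim s hs
    · exact sub_eq_zero.1 (pow_eq_zero_iff two_ne_zero |>.1 this)
    · obtain ⟨-, h1, -⟩ := ha s hs
      have e := profile_add_saddleHeight (l := l) (by omega) i (u s 1 - h)
      rw [← hh, sub_add_cancel] at e
      rw [e]
      set δ := u s 1 - h
      obtain ⟨h1a, h1b⟩ := abs_lt.1 h1
      have hb : (2 * (l : ℝ) - 1) * δ < 1 := by
        have := mul_lt_mul_of_pos_left h1b hN
        rwa [mul_one_div_cancel hN.ne'] at this
      have hb' : -1 < (2 * (l : ℝ) - 1) * δ := by
        have := mul_lt_mul_of_pos_left h1a hN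
        rwa [mul_neg, mul_one_div_cancel hN.ne'] at this
      have hpi := Real.pi_pos
      have hc : 0 < 2 / (Real.pi * (2 * l - 1)) := div_pos two_pos (mul_pos hpi hN)
      have hs : 0 ≤ δ * Real.sin (Real.pi * ((2 * l - 1) * δ)) := by
        rcases le_total 0 δ with hδ | hδ
        · exact mul_nonneg hδ (Real.sin_nonneg_of_nonneg_of_le_pi (by positivity) (by nlinarith))
        · refine mul_nonneg_of_nonpos_of_nonpos hδ (Real.sin_nonpos_of_nonpos_of_neg_pi_le ?_ ?_)
          · exact mul_nonpos_of_nonneg_of_nonpos hpi.le (mul_nonpos_of_nonneg_of_nonpos hN.le hδ)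
          · nlinarith
      have := mul_nonneg hc.le hs
      linarith
  have hx : ∀ s ≤ a, u s 0 + 2 = (u a 0 + 2) * Real.exp (s - a) := by
    refine eq_const_mul_exp_of_hasDerivAt (f := fun s => u s 0 + 2) fun s hs => ?_
    have := (hasDerivAt_coord (hu s) 0).add_const 2
    rw [hloc s hs] at this
    exact this.congr_deriv (by simp)
  set C := (u a 0 + 2) * Real.exp (-a) with hC
  have hxC : ∀ s ≤ a, u s 0 = -2 + C * Real.exp s := fun s hs => by
    have := hx s hs
    rw [sub_eq_add_neg s a, Real.exp_add] at this
    rw [hC]; linarith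
  rcases le_or_gt C 0 with hC0 | hC0
  · exfalso
    have he : IsOrbit l fun s => !₂[-2 + C * Real.exp s, saddleHeight l i, 0] := fun s =>
      hasDerivAt_left_ray (by omega) hi (by nlinarith [Real.exp_pos s])
    have hue := hu.eq he (s := a) (vec_ext (hxC a le_rfl) (hy a le_rfl) (hz a))
    have hle : ∀ s, u s 0 ≤ -2 := fun s => by
      rw [hue]
      simp only [Matrix.cons_val]
      nlinarith [Real.exp_pos s]
    have := le_of_tendsto' (tendsto_coord htop 0) hle
    norm_num at this
  -- The shift by log (8C) turns the amplitude 1/8 of `γ` into C; the minimum keeps the shifted time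
  -- nonpositive, where `γ` is explicit.
  · set s₁ := min a (-Real.log (8 * C)) with hs₁
    have h1 : s₁ ≤ a := min_le_left _ _
    have h2 : s₁ + Real.log (8 * C) ≤ 0 := by
      have : s₁ ≤ -Real.log (8 * C) := min_le_right _ _
      linarith
    refine hu.exists_shift hγ (a := s₁) (b := s₁ + Real.log (8 * C)) ?_
    rw [hray _ h2]
    refine vec_ext ?_ (hy _ h1) (hz _)
    rw [hxC _ h1, Real.exp_add, Real.exp_log (by linarith)]
    ring

/-- On the x-axis the equation is x' = x(x - 1/3), solved by the logistic function (1/3) / (1 + exp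
(s/3)), which sweeps out the whole segment. -/
theorem exists_separatrix_axis {l : ℕ} (hl : 2 ≤ l) :
    ∃ γ, IsOrbit l γ ∧ (∀ s, γ s ∈ planarBasin l) ∧
      Tendsto γ atBot (𝓝 !₂[1 / 3, 0, 0]) ∧ Tendsto γ atTop (𝓝 0) ∧
      ∀ x, 0 < x → x < 1 / 3 → ∃ s, γ s = !₂[x, 0, 0] := by
  obtain ⟨h1, h2, -, -, -⟩ := heights hl
  have hpos : ∀ s : ℝ, 0 < 1 + Real.exp (s / 3) := fun s => by positivity
  have hb : ∀ s : ℝ, 0 < 1 / 3 / (1 + Real.exp (s / 3)) ∧ 1 / 3 / (1 + Real.exp (s / 3)) < 1 / 3 :=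
    fun s => by
      refine ⟨div_pos (by norm_num) (hpos s), ?_⟩
      rw [div_lt_iff₀ (hpos s)]
      nlinarith [Real.exp_pos (s / 3)]
  refine ⟨fun s => !₂[1 / 3 / (1 + Real.exp (s / 3)), 0, 0], fun s => ?_, fun s => ?_, ?_, ?_, ?_⟩
  · obtain ⟨b0, b1⟩ := hb s
    have e := model_axis (l := l) (m := 1 / 3) (n := 1)
      (x := 1 / 3 / (1 + Real.exp (s / 3))) (by rw [abs_of_pos b0]; linarith)
    refine HasDerivAt.congr_deriv ?_ e.symm
    have hd : HasDerivAt (fun s => 1 / 3 / (1 + Real.exp (s / 3)))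
        ((0 * (1 + Real.exp (s / 3)) - 1 / 3 * (Real.exp (s / 3) * (1 / 3)))
          / (1 + Real.exp (s / 3)) ^ 2) s :=
      (hasDerivAt_const s (1 / 3 : ℝ)).div
        ((((hasDerivAt_id s).div_const 3).exp).const_add 1) (hpos s).ne'
    refine (hasDerivAt_vec hd (hasDerivAt_const s (0 : ℝ)) (hasDerivAt_const s (0 : ℝ))).congr_deriv
      ?_
    congr 3
    have := (hpos s).ne'
    field_simp
    ring
  · obtain ⟨b0, b1⟩ := hb s
    exact ⟨by simp only [Matrix.cons_val]; linarith, by simpa using b1,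
      by simpa using h1.trans h2, by simp⟩
  · refine tendsto_of_coord fun j => ?_
    have hlim : Tendsto (fun s : ℝ => Real.exp (s / 3)) atBot (𝓝 0) :=
      Real.tendsto_exp_atBot.comp (tendsto_id.atBot_div_const (by norm_num))
    fin_cases j
    · have := (tendsto_const_nhds (x := (1 / 3 : ℝ))).div (hlim.const_add 1) (by norm_num)
      rw [add_zero, div_one] at this
      exact this
    · exact tendsto_const_nhds
    · exact tendsto_const_nhds
  · refine tendsto_of_coord fun j => ?_
    have hlim : Tendsto (fun s : ℝ => 1 + Real.exp (s / 3)) atTop atTop :=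
      tendsto_atTop_add_const_left _ _
        (Real.tendsto_exp_atTop.comp (tendsto_id.atTop_div_const (by norm_num)))
    fin_cases j
    · exact hlim.const_div_atTop _
    · exact tendsto_const_nhds
    · exact tendsto_const_nhds
  · intro x hx hx'
    have hq : 0 < 1 / 3 / x - 1 := by
      rw [sub_pos, lt_div_iff₀ hx]; linarith
    refine ⟨3 * Real.log (1 / 3 / x - 1), ?_⟩
    have e : 1 / 3 / (1 + Real.exp (3 * Real.log (1 / 3 / x - 1) / 3)) = x := by
      rw [mul_div_cancel_left₀ _ (by norm_num : (3 : ℝ) ≠ 0), Real.exp_log hq]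
      field_simp
      ring
    simp only [e]

/-- Near time -∞ the orbit satisfies y' = -y, hence y = 0. On the axis, starting at 1/3 or to its
right excludes the origin as limit. -/
theorem exists_shift_axis {l : ℕ} {γ u : ℝ → Space}
    (hγ : IsOrbit l γ) (hray : ∀ x, 0 < x → x < 1 / 3 → ∃ s, γ s = !₂[x, 0, 0])
    (hu : IsOrbit l u) (hbot : Tendsto u atBot (𝓝 !₂[1 / 3, 0, 0]))
    (htop : Tendsto u atTop (𝓝 0)) : ∃ τ, ∀ s, u s = γ (s + τ) := by
  have hz := hu.two_eq_zero_of_tendsto htop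
  obtain ⟨a, ha⟩ := eventually_atBot.1 ((eventually_abs_sub_lt hbot 0 (by norm_num : 0 < (1 : ℝ) / 6)).and
    (eventually_abs_sub_lt hbot 1 (by norm_num : 0 < (1 : ℝ) / 2)))
  simp only [Matrix.cons_val, sub_zero] at ha
  have hx : ∀ s ≤ a, 0 < u s 0 ∧ u s 0 ≤ 1 / 2 := fun s hs => by
    obtain ⟨b, c⟩ := abs_lt.1 (ha s hs).1
    constructor <;> linarith
  have hy : ∀ s ≤ a, u s 1 = 0 := by
    have hd : ∀ s ≤ a, HasDerivAt (fun s => u s 1 ^ 2) (2 * u s 1 * -u s 1) s := fun s hs => by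
      have := (hasDerivAt_coord (hu s) 1).pow 2
      rw [(finalModel_of_strip (ha s hs).2.le (hz s)).2,
        cutoff_eq_one (by rw [abs_of_pos (hx s hs).1]; exact (hx s hs).2)] at this
      exact this.congr_deriv (by simp)
    have hlim : Tendsto (fun s => u s 1 ^ 2) atBot (𝓝 0) := by
      simpa using (tendsto_coord hbot 1).pow 2
    intro s hs
    exact pow_eq_zero_iff two_ne_zero |>.1 (eq_zero_of_deriv_nonpos_of_tendsto_atBot hd
      (fun s _ => sq_nonneg _) (fun s _ => by nlinarith [sq_nonneg (u s 1)]) hlim s hs)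
  rcases lt_trichotomy (u a 0) (1 / 3) with h | h | h
  · obtain ⟨b, hb⟩ := hray _ (hx a le_rfl).1 h
    exact hu.exists_shift hγ (a := a) (b := b)
      (hb ▸ vec_ext rfl (hy a le_rfl) (hz a))
  · exfalso
    have hc : IsOrbit l fun _ => !₂[1 / 3, 0, 0] := fun s => by
      have e := (isNegativeNull_axis (l := l) (m := 1 / 3) (by norm_num) le_rfl).1.1
      exact (hasDerivAt_const _ _).congr_deriv e.symm
    have := hu.eq hc (s := a) (vec_ext h (hy a le_rfl) (hz a))
    have h0 := tendsto_coord htop 0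
    rw [this] at h0
    have := tendsto_nhds_unique h0 tendsto_const_nhds
    norm_num at this
  · exfalso
    -- That y = 0 has been shown only up to time `a`, so x' > 0 is checked at every height of the
    -- plane z = 0.
    have hle : ∀ s, a ≤ s → u a 0 ≤ u s 0 := by
      refine le_of_deriv_pos_of_eq (fun s _ => hasDerivAt_coord (hu s) 0) le_rfl fun s _ e => ?_
      have e' : u s 0 = u a 0 := e
      simp only [model, localizer, hz s, cutoff_eq_one (x := 0) (by norm_num), Matrix.cons_val, e']
      set x := u a 0
      have c0 := cutoff_nonneg x
      have c1 := cutoff_le_one x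
      have t0 := tightCutoff_nonneg l (u s 1)
      have t1 := tightCutoff_le_one l (u s 1)
      have hxx : 0 < x * (x - 1 / 3) := mul_pos (by linarith) (by linarith)
      have key : 0 < (1 - tightCutoff l (u s 1)) + tightCutoff l (u s 1) * (x * (x - 1 / 3)) := by
        rcases t0.lt_or_eq with h | h
        · nlinarith [mul_pos h hxx]
        · rw [← h]; norm_num
      have : 0 < (1 - cutoff x) * (x + 2) + cutoff x *
          ((1 - tightCutoff l (u s 1)) + tightCutoff l (u s 1) * (x * (x - 1 / 3))) := by
        rcases c0.lt_or_eq with h' | h'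
        · nlinarith [mul_pos h' key]
        · rw [← h']; linarith
      linarith
    have := ge_of_tendsto (tendsto_coord htop 0) (eventually_atTop.2 ⟨a, hle⟩)
    simp only [PiLp.zero_apply] at this
    linarith

/-- Every negative null point of the final model has a unique field line to the origin. -/
theorem exists_separatrix {l : ℕ} (hl : 2 ≤ l) {q : Space}
    (hq : q ∈ insert (!₂[1 / 3, 0, 0] : Space) (saddles l)) :
    ∃ γ, IsOrbit l γ ∧ (∀ s, γ s ∈ planarBasin l) ∧ Tendsto γ atBot (𝓝 q) ∧
      Tendsto γ atTop (𝓝 0) ∧ ∀ u, IsOrbit l u → Tendsto u atBot (𝓝 q) → Tendsto u atTop (𝓝 0) →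
        ∃ τ, ∀ s, u s = γ (s + τ) := by
  rcases hq with rfl | ⟨i, hi, rfl⟩
  · obtain ⟨γ, h1, h2, h3, h4, h5⟩ := exists_separatrix_axis hl
    exact ⟨γ, h1, h2, h3, h4, fun u => exists_shift_axis h1 h5⟩
  · obtain ⟨γ, h1, h2, h3, h4, h5⟩ := exists_separatrix_saddle hl hi
    exact ⟨γ, h1, h2, h3, h4, fun u => exists_shift_saddle hl hi h1 h5⟩

/-! ### The stable and unstable manifolds along the separatrices -/

theorem exists_forward_of_mem_planarBasin {l : ℕ} (hl : 2 ≤ l) {v : Space}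
    (hv : v ∈ planarBasin l) :
    ∃ u, u 0 = v ∧ IsOrbit l u ∧ (∀ s, 0 ≤ s → ‖u s‖ < 4) ∧ Tendsto u atTop (𝓝 0) := by
  obtain ⟨h1, h2, h3, h4, h5⟩ := heights hl
  obtain ⟨u, rfl, hu⟩ := exists_isOrbit l v
  obtain ⟨a, b, c, d⟩ := hv
  obtain ⟨hf, hlim⟩ := hu.forward (h1.trans h2) h3 h5 d c.le a b
  refine ⟨u, rfl, hu, fun s hs => ?_, hlim⟩
  obtain ⟨a, b, c, d⟩ := hf s hs
  exact norm_lt_four (abs_le.2 ⟨by linarith, by linarith⟩) (by linarith) (by rw [d]; simp)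

theorem norm_lt_of_mem_planarBasin {l : ℕ} (hl : 2 ≤ l) {v : Space} (hv : v ∈ planarBasin l) :
    ‖v‖ < 4 := by
  obtain ⟨h1, h2, h3, h4, h5⟩ := heights hl
  obtain ⟨a, b, c, d⟩ := hv
  exact norm_lt_four (abs_le.2 ⟨by linarith, by linarith⟩) (by linarith) (by rw [d]; simp)

/-- The cutoff in z equals 1 on |z| ≤ 1/2, so the localizer does not change with z there. -/
theorem finalModel_of_lift {l : ℕ} {v : Space} (h2 : v 2 = 0) {z : ℝ} (hz : |z| ≤ 1 / 2) :
    finalModel l !₂[v 0, v 1, z] = !₂[finalModel l v 0, finalModel l v 1, z * rate l v] := by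
  have e : localizer l !₂[v 0, v 1, z] = localizer l v := by
    simp only [localizer, Matrix.cons_val, h2, cutoff_eq_one hz,
      cutoff_eq_one (x := 0) (by norm_num)]
  refine vec_ext ?_ ?_ ?_
  · simp only [model, Matrix.cons_val, e]
  · simp only [model, Matrix.cons_val]
  · rw [finalModel_two]
    simp only [rate, Matrix.cons_val, e]

/-- Above a planar orbit the z-equation is linear, solved by z exp A with A the integral of `rate`.
As `rate` ≥ 1/10, this tends to 0 backwards in time, so a vertical segment lies in the unstable
manifold. -/
theorem exists_backward_of_lift {l : ℕ} (hl : 2 ≤ l) {γ : ℝ → Space} {q : Space}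
    (hγ : IsOrbit l γ) (hb : ∀ s, γ s ∈ planarBasin l) (hq : Tendsto γ atBot (𝓝 q))
    (hq2 : q 2 = 0) {z : ℝ} (hz : |z| ≤ 1 / 2) :
    ∃ w : ℝ → Space, w 0 = !₂[γ 0 0, γ 0 1, z] ∧
      (∀ s ≤ 0, ‖w s‖ < 4 ∧ HasDerivAt w (finalModel l (w s)) s) ∧ Tendsto w atBot (𝓝 q) := by
  obtain ⟨h1, h2, h3, h4, h5⟩ := heights hl
  have hcont : Continuous fun s => rate l (γ s) := by
    have hγc : Continuous γ := continuous_iff_continuousAt.2 fun s => (hγ s).continuousAt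
    have hloc : Continuous (localizer l) :=
      ((contDiff_cutoff (n := 0)).continuous.comp (by fun_prop)).mul
        ((contDiff_tightCutoff l (n := 0)).continuous.comp (by fun_prop)) |>.mul
        ((contDiff_cutoff (n := 0)).continuous.comp (by fun_prop))
    have : Continuous (rate l) := by unfold rate; fun_prop
    exact this.comp hγc
  set A : ℝ → ℝ := fun s => ∫ r in (0 : ℝ)..s, rate l (γ r) with hA
  have hAd : ∀ s, HasDerivAt A (rate l (γ s)) s := fun s =>
    (hcont.integral_hasStrictDerivAt 0 s).hasDerivAt
  have hA0 : A 0 = 0 := by simp [hA]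
  have hAle : ∀ s ≤ 0, A s ≤ s / 10 := by
    have hm : Monotone fun s => A s - s / 10 := by
      have hd : ∀ s, HasDerivAt (fun s => A s - s / 10) (rate l (γ s) - 1 / 10) s := fun s =>
        (hAd s).sub ((hasDerivAt_id s).div_const 10)
      refine monotone_of_deriv_nonneg (fun s => (hd s).differentiableAt) fun s => ?_
      rw [(hd s).deriv]
      linarith [(rate_mem l (γ s)).1]
    intro s hs
    have := hm hs
    simp only [hA0] at this
    linarith
  have hle : ∀ s ≤ 0, |z * Real.exp (A s)| ≤ |z| * Real.exp (s / 10) := fun s hs => by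
    rw [abs_mul, Real.abs_exp]
    gcongr
    exact hAle s hs
  have hle' : ∀ s ≤ 0, |z * Real.exp (A s)| ≤ 1 / 2 := fun s hs => by
    refine (hle s hs).trans ((mul_le_of_le_one_right (abs_nonneg z) ?_).trans hz)
    exact Real.exp_le_one_iff.2 (by linarith)
  refine ⟨fun s => !₂[γ s 0, γ s 1, z * Real.exp (A s)], by simp [hA0], fun s hs => ⟨?_, ?_⟩, ?_⟩
  · obtain ⟨a, b, c, d⟩ := hb s
    refine norm_lt_four (v := !₂[γ s 0, γ s 1, z * Real.exp (A s)])
      (abs_le.2 ⟨a.le, by simp only [Matrix.cons_val]; linarith⟩) ?_ ?_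
    · simp only [Matrix.cons_val]; linarith
    · have := hle' s hs
      simp only [Matrix.cons_val]; linarith
  · rw [finalModel_of_lift (hb s).2.2.2 (hle' s hs)]
    refine (hasDerivAt_vec (hasDerivAt_coord (hγ s) 0) (hasDerivAt_coord (hγ s) 1)
      (((hAd s).exp).const_mul z)).congr_deriv ?_
    rw [mul_assoc]
  · refine tendsto_of_coord fun j => ?_
    fin_cases j
    · exact tendsto_coord hq 0
    · exact tendsto_coord hq 1
    · have : Tendsto (fun s => z * Real.exp (A s)) atBot (𝓝 0) := by
        have hlim : Tendsto (fun s : ℝ => |z| * Real.exp (s / 10)) atBot (𝓝 0) := by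
          simpa using (Real.tendsto_exp_atBot.comp
            (tendsto_id.atBot_div_const (by norm_num : (0 : ℝ) < 10))).const_mul |z|
        refine squeeze_zero_norm' ?_ hlim
        filter_upwards [eventually_le_atBot 0] with s hs
        exact hle s hs
      simpa [hq2] using this

/-! ### Fields that contain a scaled copy of the final model -/

theorem admissible_final : Admissible (1 / 3) 1 :=
  ⟨by norm_num, le_rfl, zero_le_one, le_rfl, .inr rfl⟩

/-- Inside the ball with centre `c` and radius `4 k` the field `F` is a scaled copy of the final
model; from there to the sphere of radius `R` it is directed outwards. -/
structure ContainsModel (l : ℕ) (F : Space → Space) (c : Space) (k R : ℝ) : Prop where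
  pos : 0 < k
  le : 4 * k ≤ R
  eq_model : ∀ u, ‖u‖ ≤ 4 → F (c + k • u) = k • finalModel l u
  outward : ∀ x, 4 * k ≤ ‖x - c‖ → ‖x - c‖ ≤ R → 0 < inner ℝ (F x) (x - c)

theorem norm_lt_of_finalModel_eq_zero {l : ℕ} (hl : 1 ≤ l) {u : Space} (hu : finalModel l u = 0) :
    ‖u‖ < 4 := by
  by_contra h
  have := inner_model_pos hl admissible_final (not_lt.1 h)
  rw [show model l (1 / 3) 1 u = 0 from hu, inner_zero_left] at this
  exact lt_irrefl _ this

theorem mem_of_isNegativeNull {l : ℕ} (hl : 1 ≤ l) {u : Space}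
    (hu : IsNegativeNull (finalModel l) u) :
    u ∈ insert (!₂[1 / 3, 0, 0] : Space) (saddles l) := by
  have hz : u ∈ zeros (finalModel l) (Metric.closedBall 0 4) :=
    ⟨mem_closedBall_zero_iff.2 (norm_lt_of_finalModel_eq_zero hl hu.1.1).le, hu.1.1⟩
  rw [zeros_model_one hl (by norm_num) le_rfl] at hz
  rcases hz with (⟨i, hi, rfl⟩ | h) | rfl | h
  · have := hu.2.1.symm.trans (isPositiveCharge_source hl _ _ hi).2
    omega
  · exact .inr h
  · have := hu.2.1.symm.trans (isPositiveNull_zero (l := l) (m := 1 / 3) (by norm_num)).2.1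
    omega
  · exact .inl h

theorem eq_zero_of_isPositiveNull {l : ℕ} (hl : 1 ≤ l) {u : Space}
    (hu : IsPositiveNull (finalModel l) u) : u = 0 := by
  have hz : u ∈ zeros (finalModel l) (Metric.closedBall 0 4) :=
    ⟨mem_closedBall_zero_iff.2 (norm_lt_of_finalModel_eq_zero hl hu.1.1).le, hu.1.1⟩
  rw [zeros_model_one hl (by norm_num) le_rfl] at hz
  rcases hz with (⟨i, hi, rfl⟩ | h) | rfl | h
  · have := hu.2.1.symm.trans (isPositiveCharge_source hl _ _ hi).2
    omega
  · have := hu.2.1.symm.trans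
      (isNegativeNull_of_mem hl (by norm_num) le_rfl (mem_insert_of_mem _ h)).2.1
    omega
  · rfl
  · have := hu.2.1.symm.trans
      (isNegativeNull_of_mem hl (by norm_num) le_rfl (mem_insert_iff.2 (.inl h))).2.1
    omega

/-! ### Transfer of zeros and field lines from the model -/

namespace ContainsModel

variable {l : ℕ} {F : Space → Space} {c : Space} {k R : ℝ}

theorem mem_closedBall (h : ContainsModel l F c k R) {u : Space} (hu : ‖u‖ ≤ 4) :
    c + k • u ∈ Metric.closedBall c R := by
  rw [mem_closedBall_iff_norm, add_sub_cancel_left, norm_smul, Real.norm_of_nonneg h.pos.le]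
  have := mul_le_mul_of_nonneg_left hu h.pos.le
  linarith [h.le]

theorem injective (h : ContainsModel l F c k R) : Function.Injective fun u : Space => c + k • u :=
  fun _ _ e => smul_right_injective _ h.pos.ne' (add_left_cancel e)

theorem add_smul_inv (h : ContainsModel l F c k R) (x : Space) : c + k • k⁻¹ • (x - c) = x := by
  rw [smul_inv_smul₀ h.pos.ne', add_sub_cancel]

theorem norm_inv_smul_lt (h : ContainsModel l F c k R) {x : Space} (hx : ‖x - c‖ < 4 * k) :
    ‖k⁻¹ • (x - c)‖ < 4 := by
  rw [norm_smul, norm_inv, Real.norm_of_nonneg h.pos.le, inv_mul_lt_iff₀ h.pos]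
  linarith

theorem norm_sub_lt_of_eq_zero (h : ContainsModel l F c k R) {x : Space}
    (hx : x ∈ Metric.closedBall c R) (h0 : F x = 0) : ‖x - c‖ < 4 * k := by
  by_contra hc
  have := h.outward x (not_lt.1 hc) (mem_closedBall_iff_norm.1 hx)
  rw [h0, inner_zero_left] at this
  exact lt_irrefl _ this

theorem eq_zero_iff (h : ContainsModel l F c k R) {u : Space} (hu : ‖u‖ < 4) :
    F (c + k • u) = 0 ↔ finalModel l u = 0 := by
  rw [h.eq_model u hu.le, smul_eq_zero, or_iff_right h.pos.ne']

/-- Scaling the argument and the values by the same factor leaves the derivative unchanged, so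
eigenvalues, Morse index and divergence carry over. -/
theorem fderiv_eq (h : ContainsModel l F c k R) {u : Space} (hu : ‖u‖ < 4) :
    fderiv ℝ F (c + k • u) = fderiv ℝ (finalModel l) u := by
  have hd : HasFDerivAt (finalModel l) (fderiv ℝ (finalModel l) u) u :=
    ((contDiff_model l (1 / 3) 1 (k := 1)).differentiable (by simp) u).hasFDerivAt
  have hi : HasFDerivAt (fun x : Space => k⁻¹ • (x - c)) (k⁻¹ • ContinuousLinearMap.id ℝ Space)
      (c + k • u) := ((hasFDerivAt_id _).sub_const c).const_smul k⁻¹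
  have hu' : k⁻¹ • ((c + k • u) - c) = u := by
    rw [add_sub_cancel_left, inv_smul_smul₀ h.pos.ne']
  have hcomp := (HasFDerivAt.comp (c + k • u) (hu'.symm ▸ hd) hi).const_smul k
  have hev : F =ᶠ[𝓝 (c + k • u)] fun x => k • finalModel l (k⁻¹ • (x - c)) := by
    have hcont : ContinuousAt (fun x : Space => ‖k⁻¹ • (x - c)‖) (c + k • u) := by fun_prop
    have : ∀ᶠ x in 𝓝 (c + k • u), ‖k⁻¹ • (x - c)‖ < 4 :=
      hcont.eventually (gt_mem_nhds (by simpa only [hu'] using hu))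
    filter_upwards [this] with x hx
    rw [← h.eq_model _ hx.le, h.add_smul_inv]
  refine (HasFDerivAt.congr_of_eventuallyEq ?_ hev).fderiv
  refine hcomp.congr_fderiv ?_
  rw [hu']
  ext v : 1
  simp [smul_smul, mul_inv_cancel₀ h.pos.ne']

theorem eigenvalues_eq (h : ContainsModel l F c k R) {u : Space} (hu : ‖u‖ < 4) :
    eigenvalues F (c + k • u) = eigenvalues (finalModel l) u := by
  rw [eigenvalues, h.fderiv_eq hu, eigenvalues]

theorem isHyperbolicZero_iff (h : ContainsModel l F c k R) {u : Space} (hu : ‖u‖ < 4) :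
    IsHyperbolicZero F (c + k • u) ↔ IsHyperbolicZero (finalModel l) u := by
  rw [IsHyperbolicZero, h.eigenvalues_eq hu, h.eq_zero_iff hu, IsHyperbolicZero]

theorem morseIndex_eq (h : ContainsModel l F c k R) {u : Space} (hu : ‖u‖ < 4) :
    morseIndex F (c + k • u) = morseIndex (finalModel l) u := by
  rw [morseIndex, h.eigenvalues_eq hu, morseIndex]

theorem divergence_eq (h : ContainsModel l F c k R) {u : Space} (hu : ‖u‖ < 4) :
    divergence F (c + k • u) = divergence (finalModel l) u := by
  rw [divergence, h.fderiv_eq hu, divergence]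

theorem isPositiveCharge_iff (h : ContainsModel l F c k R) {u : Space} (hu : ‖u‖ < 4) :
    IsPositiveCharge F (c + k • u) ↔ IsPositiveCharge (finalModel l) u := by
  rw [IsPositiveCharge, h.isHyperbolicZero_iff hu, h.morseIndex_eq hu, IsPositiveCharge]

theorem isNegativeNull_iff (h : ContainsModel l F c k R) {u : Space} (hu : ‖u‖ < 4) :
    IsNegativeNull F (c + k • u) ↔ IsNegativeNull (finalModel l) u := by
  rw [IsNegativeNull, h.isHyperbolicZero_iff hu, h.morseIndex_eq hu, h.divergence_eq hu,
    IsNegativeNull]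

theorem isPositiveNull_iff (h : ContainsModel l F c k R) {u : Space} (hu : ‖u‖ < 4) :
    IsPositiveNull F (c + k • u) ↔ IsPositiveNull (finalModel l) u := by
  rw [IsPositiveNull, h.isHyperbolicZero_iff hu, h.morseIndex_eq hu, h.divergence_eq hu,
    IsPositiveNull]

/-- Outward direction confines the zeros of `F` to the inner ball, so a property that implies
vanishing can be counted in the model. It is applied to each type of zero. -/
theorem encard_eq (h : ContainsModel l F c k R) (hl : 1 ≤ l)
    {P : (Space → Space) → Space → Prop} (hP : ∀ G p, P G p → G p = 0)
    (hiff : ∀ u, ‖u‖ < 4 → (P F (c + k • u) ↔ P (finalModel l) u)) :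
    {p ∈ Metric.closedBall c R | P F p}.encard
      = {u ∈ Metric.closedBall 0 4 | P (finalModel l) u}.encard := by
  rw [← h.injective.encard_image {u ∈ Metric.closedBall 0 4 | P (finalModel l) u}]
  congr 1
  ext x
  constructor
  · rintro ⟨hx, hp⟩
    have hu := h.norm_inv_smul_lt (h.norm_sub_lt_of_eq_zero hx (hP _ _ hp))
    refine ⟨k⁻¹ • (x - c), ⟨mem_closedBall_zero_iff.2 hu.le, ?_⟩, h.add_smul_inv x⟩
    rw [← hiff _ hu, h.add_smul_inv]
    exact hp
  · rintro ⟨u, ⟨-, hp⟩, rfl⟩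
    have hu := norm_lt_of_finalModel_eq_zero hl (hP _ _ hp)
    exact ⟨h.mem_closedBall hu.le, (hiff u hu).2 hp⟩

theorem hasCounts (h : ContainsModel l F c k R) (hl : 1 ≤ l) :
    HasCounts F (Metric.closedBall c R) l l 1 := by
  have hm := hasCounts_model_one hl (m := 1 / 3) (by norm_num) le_rfl
  refine ⟨fun x hx => ?_, ?_, ?_, ?_⟩
  · have hu := h.norm_inv_smul_lt (h.norm_sub_lt_of_eq_zero hx.1 hx.2)
    have e := h.add_smul_inv x
    rw [← e, h.isPositiveCharge_iff hu, h.isNegativeNull_iff hu, h.isPositiveNull_iff hu]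
    refine hm.classified _ ⟨mem_closedBall_zero_iff.2 hu.le, ?_⟩
    rw [← h.eq_zero_iff hu, e]
    exact hx.2
  · rw [h.encard_eq hl (fun _ _ hp => hp.1.1) fun u => h.isPositiveCharge_iff]
    exact hm.positiveCharges
  · rw [h.encard_eq hl (fun _ _ hp => hp.1.1) fun u => h.isNegativeNull_iff]
    exact hm.negativeNulls
  · rw [h.encard_eq hl (fun _ _ hp => hp.1.1) fun u => h.isPositiveNull_iff]
    exact hm.positiveNulls

/-- A field line that tends to a point of the inner ball has never left the inner ball. -/
theorem norm_sub_lt (h : ContainsModel l F c k R) {γ : ℝ → Space} {p : Space}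
    (hγ : ∀ s, γ s ∈ Metric.closedBall c R ∧ HasDerivAt γ (F (γ s)) s)
    (hp : Tendsto γ atTop (𝓝 p)) (hpk : ‖p - c‖ < 4 * k) (a : ℝ) : ‖γ a - c‖ < 4 * k := by
  by_contra hc
  push Not at hc
  have hd : ∀ s, HasDerivAt (fun s => ‖γ s - c‖ ^ 2) (2 * inner ℝ (F (γ s)) (γ s - c)) s :=
    fun s => by
      have := ((hγ s).2.sub_const c).norm_sq
      rwa [real_inner_comm] at this
  have hle : ∀ s, a ≤ s → ‖γ a - c‖ ^ 2 ≤ ‖γ s - c‖ ^ 2 := by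
    refine le_of_deriv_pos_of_eq (fun s _ => hd s) le_rfl fun s _ e => ?_
    have e' : ‖γ s - c‖ = ‖γ a - c‖ :=
      (sq_eq_sq₀ (norm_nonneg _) (norm_nonneg _)).1 e
    have := h.outward (γ s) (e' ▸ hc) (mem_closedBall_iff_norm.1 (hγ s).1)
    linarith
  have hlim : Tendsto (fun s => ‖γ s - c‖ ^ 2) atTop (𝓝 (‖p - c‖ ^ 2)) :=
    ((hp.sub_const c).norm).pow 2
  have h1 := ge_of_tendsto hlim (eventually_atTop.2 ⟨a, hle⟩)
  have h2 := (sq_le_sq₀ (norm_nonneg _) (norm_nonneg _)).1 h1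
  linarith

theorem hasDerivWithinAt (h : ContainsModel l F c k R) {u : ℝ → Space} {t : Set ℝ} {s : ℝ}
    (hu : ‖u s‖ < 4) (hd : HasDerivAt u (finalModel l (u s)) s) :
    HasDerivWithinAt (fun s => c + k • u s) (F (c + k • u s)) t s := by
  rw [h.eq_model _ hu.le]
  exact ((hd.const_smul k).const_add c).hasDerivWithinAt

theorem tendsto_image {u : ℝ → Space} {f : Filter ℝ} {p : Space} (c : Space) (k : ℝ)
    (hu : Tendsto u f (𝓝 p)) : Tendsto (fun s => c + k • u s) f (𝓝 (c + k • p)) :=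
  (hu.const_smul k).const_add c

theorem mem_stableSet (h : ContainsModel l F c k R) (hl : 2 ≤ l) {v : Space}
    (hv : v ∈ planarBasin l) : c + k • v ∈ stableSet F (Metric.closedBall c R) c := by
  obtain ⟨u, rfl, hu, hb, hlim⟩ := exists_forward_of_mem_planarBasin hl hv
  refine ⟨fun s => c + k • u s, rfl, fun s hs =>
    ⟨h.mem_closedBall (hb s hs).le, h.hasDerivWithinAt (hb s hs) (hu s)⟩, ?_⟩
  simpa using tendsto_image c k hlim

theorem mem_unstableSet (h : ContainsModel l F c k R) (hl : 2 ≤ l) {γ : ℝ → Space} {q : Space}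
    (hγ : IsOrbit l γ) (hb : ∀ s, γ s ∈ planarBasin l) (hq : Tendsto γ atBot (𝓝 q))
    (hq2 : q 2 = 0) (a : ℝ) {z : ℝ} (hz : |z| ≤ 1 / 2) :
    c + k • (!₂[γ a 0, γ a 1, z] : Space)
      ∈ unstableSet F (Metric.closedBall c R) (c + k • q) := by
  obtain ⟨w, hw0, hw, hlim⟩ := exists_backward_of_lift hl (hγ.comp_add a) (fun s => hb (s + a))
    (hq.comp (tendsto_atBot_add_const_right _ a tendsto_id)) hq2 hz
  rw [zero_add] at hw0
  exact ⟨fun s => c + k • w s, by simp only [hw0], fun s hs =>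
    ⟨h.mem_closedBall (hw s hs).1.le, h.hasDerivWithinAt (hw s hs).1 (hw s hs).2⟩,
    tendsto_image c k hlim⟩

end ContainsModel

/-! ### Transversality and the number of separators -/

theorem mem_tangentVectors_of_line {W : Set Space} {x e : Space}
    (h : ∀ᶠ s : ℝ in 𝓝 0, x + s • e ∈ W) : e ∈ tangentVectors W x := by
  refine ⟨fun s => x + s • e, by fun_prop, by simp, ?_, h⟩
  have : HasDerivAt (fun s : ℝ => x + s • e) ((1 : ℝ) • e) 0 :=
    ((hasDerivAt_id (0 : ℝ)).smul_const e).const_add x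
  rw [this.deriv, one_smul]

theorem span_eq_top_of_single {T : Set Space}
    (h : ∀ i : Fin 3, EuclideanSpace.single i (1 : ℝ) ∈ T) : Submodule.span ℝ T = ⊤ := by
  rw [eq_top_iff, ← (EuclideanSpace.basisFun (Fin 3) ℝ).toBasis.span_eq]
  refine Submodule.span_mono ?_
  rintro _ ⟨i, rfl⟩
  simpa using h i

namespace ContainsModel

variable {l : ℕ} {F : Space → Space} {c : Space} {k R : ℝ}

/-- The basin, open in the plane z = 0, supplies the first two coordinate directions to the stable
manifold; the vertical lift supplies the third to the unstable one. -/
theorem transverseAt (h : ContainsModel l F c k R) (hl : 2 ≤ l) {γ : ℝ → Space} {q : Space}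
    (hγ : IsOrbit l γ) (hb : ∀ s, γ s ∈ planarBasin l) (hq : Tendsto γ atBot (𝓝 q))
    (hq2 : q 2 = 0) (a : ℝ) :
    TransverseAt (unstableSet F (Metric.closedBall c R) (c + k • q))
      (stableSet F (Metric.closedBall c R) c) (c + k • γ a) := by
  have hk := h.pos.ne'
  have hline : ∀ (e : Space) (s : ℝ), c + k • γ a + s • e = c + k • (γ a + (s / k) • e) :=
    fun e s => by
      rw [smul_add, smul_smul, mul_div_cancel₀ _ hk, add_assoc]
  obtain ⟨b0, b1, b2, b3⟩ := hb a
  refine span_eq_top_of_single fun i => ?_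
  fin_cases i
  · right
    refine mem_tangentVectors_of_line ?_
    have hc : ContinuousAt (fun s : ℝ => γ a 0 + s / k) 0 := by fun_prop
    have e0 : γ a 0 + 0 / k = γ a 0 := by simp
    filter_upwards [hc.eventually (lt_mem_nhds (e0.symm ▸ b0)),
      hc.eventually (gt_mem_nhds (e0.symm ▸ b1))] with s h0 h1
    rw [hline]
    exact h.mem_stableSet hl ⟨by simpa using h0, by simpa using h1, by simpa using b2,
      by simpa using b3⟩
  · right
    refine mem_tangentVectors_of_line ?_
    have hc : ContinuousAt (fun s : ℝ => |γ a 1 + s / k|) 0 := by fun_prop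
    have e0 : |γ a 1 + 0 / k| = |γ a 1| := by simp
    filter_upwards [hc.eventually (gt_mem_nhds (e0.symm ▸ b2))] with s h1
    rw [hline]
    exact h.mem_stableSet hl ⟨by simpa using b0, by simpa using b1, by simpa using h1,
      by simpa using b3⟩
  · left
    refine mem_tangentVectors_of_line ?_
    have hc : ContinuousAt (fun s : ℝ => |s / k|) 0 := by fun_prop
    have h0 : |(0 : ℝ) / k| < 1 / 2 := by simp
    filter_upwards [hc.eventually (gt_mem_nhds h0)] with s h1
    have e : γ a + (s / k) • EuclideanSpace.single 2 (1 : ℝ) = !₂[γ a 0, γ a 1, s / k] :=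
      vec_ext (by simp) (by simp) (by simp [b3])
    rw [hline]
    exact e ▸ h.mem_unstableSet hl hγ hb hq hq2 a h1.le

theorem isSeparator (h : ContainsModel l F c k R) (hl : 2 ≤ l) {γ : ℝ → Space} {q : Space}
    (hγ : IsOrbit l γ) (hb : ∀ s, γ s ∈ planarBasin l) (hbot : Tendsto γ atBot (𝓝 q))
    (htop : Tendsto γ atTop (𝓝 0)) (hq : q ∈ insert (!₂[1 / 3, 0, 0] : Space) (saddles l)) :
    IsSeparator F (Metric.closedBall c R) (range fun s => c + k • γ s) := by
  have hnull := isNegativeNull_of_mem (l := l) (by omega) (by norm_num) le_rfl hq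
  have hq4 := norm_lt_of_finalModel_eq_zero (by omega) hnull.1.1
  have hq2 : q 2 = 0 := by
    rcases hq with rfl | ⟨i, -, rfl⟩ <;> simp
  have hb4 : ∀ s, ‖γ s‖ < 4 := fun s => norm_lt_of_mem_planarBasin hl (hb s)
  have hc := h.mem_closedBall (u := 0) (by simp)
  have hp : IsPositiveNull F (c + k • 0) :=
    (h.isPositiveNull_iff (by simp)).2 (isPositiveNull_zero (by norm_num))
  rw [smul_zero, add_zero] at hc hp
  refine ⟨c + k • q, h.mem_closedBall hq4.le, c, hc, (h.isNegativeNull_iff hq4).2 hnull, hp,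
    ⟨fun s => c + k • γ s, fun s => ⟨h.mem_closedBall (hb4 s).le, ?_⟩, tendsto_image c k hbot, ?_,
      rfl⟩, ?_⟩
  · rw [← hasDerivWithinAt_univ]
    exact h.hasDerivWithinAt (hb4 s) (hγ s)
  · simpa using tendsto_image c k htop
  · rintro _ ⟨a, rfl⟩
    exact h.transverseAt hl hγ hb hbot hq2 a

/-- Every separator is the image of a field line of the model from a negative null point to the
origin. -/
theorem exists_of_isSeparator (h : ContainsModel l F c k R) (hl : 1 ≤ l) {S : Set Space}
    (hS : IsSeparator F (Metric.closedBall c R) S) :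
    ∃ q ∈ insert (!₂[1 / 3, 0, 0] : Space) (saddles l), ∃ u, IsOrbit l u ∧
      Tendsto u atBot (𝓝 q) ∧ Tendsto u atTop (𝓝 0) ∧ S = range fun s => c + k • u s := by
  obtain ⟨q, hqB, p, hpB, hq, hp, ⟨γ, hγ, hbot, htop, rfl⟩, -⟩ := hS
  have hq4 := h.norm_inv_smul_lt (h.norm_sub_lt_of_eq_zero hqB hq.1.1)
  have hpk := h.norm_sub_lt_of_eq_zero hpB hp.1.1
  have hp4 := h.norm_inv_smul_lt hpk
  have hin : ∀ s, ‖k⁻¹ • (γ s - c)‖ < 4 := fun s =>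
    h.norm_inv_smul_lt (h.norm_sub_lt hγ htop hpk s)
  rw [← h.add_smul_inv q, h.isNegativeNull_iff hq4] at hq
  rw [← h.add_smul_inv p, h.isPositiveNull_iff hp4] at hp
  have hp0 := eq_zero_of_isPositiveNull hl hp
  refine ⟨_, mem_of_isNegativeNull hl hq, fun s => k⁻¹ • (γ s - c), fun s => ?_,
    (hbot.sub_const c).const_smul k⁻¹, ?_, ?_⟩
  · have hd := ((hγ s).2.sub_const c).const_smul k⁻¹
    have e := h.eq_model _ (hin s).le
    rw [h.add_smul_inv] at e
    rwa [e, inv_smul_smul₀ h.pos.ne'] at hd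
  · rw [← hp0]
    exact (htop.sub_const c).const_smul k⁻¹
  · simp only [h.add_smul_inv]

/-- Separators correspond to negative null points: each has one field line to the origin up to time
shift, and a field line determines its limit at time -∞. -/
theorem separatorCount_eq (h : ContainsModel l F c k R) (hl : 2 ≤ l) :
    separatorCount F (Metric.closedBall c R) = l := by
  have hex := fun q (hq : q ∈ insert (!₂[1 / 3, 0, 0] : Space) (saddles l)) =>
    exists_separatrix hl hq
  choose! γ hγ hb hbot htop huniq using hex
  have hset : {S | IsSeparator F (Metric.closedBall c R) S}
      = (fun q => range fun s => c + k • γ q s) ''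
        insert (!₂[1 / 3, 0, 0] : Space) (saddles l) := by
    ext S
    constructor
    · intro hS
      obtain ⟨q, hq, u, hu, hub, hut, rfl⟩ := h.exists_of_isSeparator (by omega) hS
      obtain ⟨τ, hτ⟩ := huniq q hq u hu hub hut
      refine ⟨q, hq, ?_⟩
      ext x
      constructor
      · rintro ⟨s, rfl⟩
        exact ⟨s - τ, by simp [hτ]⟩
      · rintro ⟨s, rfl⟩
        exact ⟨s + τ, by simp [hτ]⟩
    · rintro ⟨q, hq, rfl⟩
      exact h.isSeparator hl (hγ q hq) (hb q hq) (hbot q hq) (htop q hq) hq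
  rw [separatorCount, hset, InjOn.encard_image,
    encard_insert_saddles (by omega) (by norm_num)]
  intro q hq q' hq' e
  have hmem : c + k • γ q 0 ∈ range fun s => c + k • γ q' s := by
    rw [← show (range fun s => c + k • γ q s) = range fun s => c + k • γ q' s from e]
    exact ⟨0, rfl⟩
  obtain ⟨b, hbq⟩ := hmem
  obtain ⟨τ, hτ⟩ := (hγ q hq).exists_shift (hγ q' hq') (h.injective hbq).symm
  have h1 := (hbot q' hq').comp (tendsto_atBot_add_const_right _ τ tendsto_id)
  exact tendsto_nhds_unique (hbot q hq) (h1.congr fun s => (hτ s).symm)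

end ContainsModel

theorem birthFamily_one (l : ℕ) : birthFamily l 1 = finalModel l := by
  have h1 : mu 1 = 1 / 3 := by norm_num [mu]
  have h2 : nu 1 = 1 := by norm_num [nu]
  rw [birthFamily, h1, h2]

theorem containsModel_birthFamily {l : ℕ} (hl : 1 ≤ l) :
    ContainsModel l (birthFamily l 1) 0 1 4 := by
  refine ⟨one_pos, by norm_num, fun u _ => by simp [birthFamily_one], fun x hx _ => ?_⟩
  rw [birthFamily_one, sub_zero]
  rw [sub_zero, mul_one] at hx
  exact inner_model_pos hl admissible_final hx

/-! ### Insertion of the model into a positively unbalanced field -/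

/-- The points where the field is not outward form a compact set missing the sphere, so their
distance from the centre has a maximum below R. -/
theorem PositivelyUnbalanced.exists_collar {F : Space → Space} {c : Space} {R : ℝ}
    (h : PositivelyUnbalanced F c R) :
    ∃ r, 0 < r ∧ r < R ∧ ∀ x, r ≤ ‖x - c‖ → ‖x - c‖ ≤ R → 0 < inner ℝ (F x) (x - c) := by
  set Z : Set Space := Metric.closedBall c R ∩ (fun x => inner ℝ (F x) (x - c)) ⁻¹' Iic 0 with hZ
  have hc : ContinuousOn (fun x => inner ℝ (F x) (x - c)) (Metric.closedBall c R) :=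
    h.smooth.continuousOn.inner (by fun_prop)
  have hcomp : IsCompact Z := (isCompact_closedBall c R).of_isClosed_subset
    (hc.preimage_isClosed_of_isClosed Metric.isClosed_closedBall isClosed_Iic) inter_subset_left
  have hR := h.radius_pos
  rcases Z.eq_empty_or_nonempty with he | hne
  · refine ⟨R / 2, by linarith, by linarith, fun x _ hx => ?_⟩
    by_contra hneg
    have : x ∈ Z := ⟨mem_closedBall_iff_norm.2 hx, not_lt.1 hneg⟩
    rw [he] at this
    exact this
  · obtain ⟨x₀, hx₀, hmax⟩ := hcomp.exists_isMaxOn hne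
      (f := fun x => ‖x - c‖) (by fun_prop)
    have hlt : ‖x₀ - c‖ < R := by
      refine lt_of_le_of_ne (mem_closedBall_iff_norm.1 hx₀.1) fun e => ?_
      have := h.outward x₀ (mem_sphere_iff_norm.2 e)
      exact absurd this (not_lt.2 hx₀.2)
    refine ⟨(‖x₀ - c‖ + R) / 2, by linarith [norm_nonneg (x₀ - c)], by linarith, fun x h1 h2 => ?_⟩
    by_contra hneg
    have : ‖x - c‖ ≤ ‖x₀ - c‖ := hmax ⟨mem_closedBall_iff_norm.2 h2, not_lt.1 hneg⟩
    linarith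

/-- Linear interpolation to the pasted field suffices: the field near the boundary sphere never
changes, and nothing is required of the zeros at intermediate times. -/
theorem exists_family_to_containsModel {l : ℕ} (hl : 1 ≤ l) {c : Space} {R : ℝ}
    {F₀ : Space → Space} (h : PositivelyUnbalanced F₀ c R) :
    ∃ F : ℝ → Space → Space, F 0 = F₀ ∧ IsContinuousFamily F (Metric.closedBall c R) ∧
      (∀ t ∈ Icc (0 : ℝ) 1, PositivelyUnbalanced (F t) c R) ∧
      (∃ K : Set Space, IsCompact K ∧ K ⊆ Metric.ball c R ∧
        ∀ t ∈ Icc (0 : ℝ) 1, ∀ x ∈ Metric.closedBall c R \ K, F t x = F₀ x) ∧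
      ∃ k, ContainsModel l (F 1) c k R := by
  obtain ⟨r, hr, hrR, hout⟩ := h.exists_collar
  -- Both radii lie strictly between `r` and `R`: the transition takes place inside the collar and
  -- ends before the boundary. The copy is scaled by r/4, so that its ball of radius 4 becomes the
  -- ball of radius `r`.
  let ψ : ContDiffBump c := ⟨(2 * r + R) / 3, (r + 2 * R) / 3, by linarith, by linarith⟩
  set k := r / 4 with hk
  have hk0 : 0 < k := by positivity
  set G : Space → Space := fun x => k • finalModel l (k⁻¹ • (x - c)) with hG
  have hGs : ContDiff ℝ ∞ G :=
    ((contDiff_model l (1 / 3) 1).comp ((contDiff_id.sub contDiff_const).const_smul k⁻¹)).const_smul k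
  set H : Space → Space := fun x => ψ x • (G x - F₀ x) with hH
  have hHs : ContDiffOn ℝ ∞ H (Metric.closedBall c R) :=
    ψ.contDiff.contDiffOn.smul (hGs.contDiffOn.sub h.smooth)
  set F : ℝ → Space → Space := fun t x => F₀ x + t • H x with hF
  have hH0 : ∀ x, (r + 2 * R) / 3 ≤ ‖x - c‖ → H x = 0 := fun x hx => by
    rw [hH]
    simp only
    rw [ψ.zero_of_le_dist (by rw [dist_eq_norm]; exact hx), zero_smul]
  have hB : UniqueDiffOn ℝ (Metric.closedBall c R) := by
    refine uniqueDiffOn_convex (convex_closedBall _ _) ?_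
    rw [interior_closedBall _ h.radius_pos.ne']
    exact ⟨c, Metric.mem_ball_self h.radius_pos⟩
  have hfam : IsContinuousFamily F (Metric.closedBall c R) := by
    have := isContinuousFamily_sum_smul (Finset.univ : Finset (Fin 2))
      (a := ![fun _ => 1, fun t => t]) (G := ![F₀, H]) hB
      (fun i _ => by fin_cases i <;> simp <;> fun_prop)
      (fun i _ => by
        fin_cases i
        · exact h.smooth
        · exact hHs)
    convert this using 1
    funext t x
    simp [hF]
  refine ⟨F, ?_, hfam, fun t ht => ⟨h.radius_pos, hfam.smooth t ht, fun x hx => ?_⟩,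
    ⟨Metric.closedBall c ((r + 2 * R) / 3), isCompact_closedBall _ _,
      Metric.closedBall_subset_ball (by linarith), fun t _ x hx => ?_⟩,
    k, hk0, by linarith, fun u hu => ?_, fun x hx hx' => ?_⟩
  · funext x
    simp [hF]
  · have : F t x = F₀ x := by
      simp only [hF]
      rw [hH0 x (by rw [mem_sphere_iff_norm.1 hx]; linarith), smul_zero, add_zero]
    rw [this]
    exact h.outward x hx
  · have hx' := hx.2
    rw [mem_closedBall_iff_norm, not_le] at hx'
    simp only [hF]
    rw [hH0 x hx'.le, smul_zero, add_zero]
  · have hψ : ψ (c + k • u) = 1 := by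
      refine ψ.one_of_mem_closedBall ?_
      rw [mem_closedBall_iff_norm, add_sub_cancel_left, norm_smul, Real.norm_of_nonneg hk0.le]
      have h1 : k * ‖u‖ ≤ k * 4 := mul_le_mul_of_nonneg_left hu hk0.le
      have h2 : k * 4 = r := by rw [hk]; ring
      have h3 : r ≤ (2 * r + R) / 3 := by linarith
      exact (h1.trans h2.le).trans h3
    simp only [hF, hH, hG]
    rw [hψ, one_smul, one_smul, add_sub_cancel, add_sub_cancel_left, inv_smul_smul₀ hk0.ne']
  · have hx4 : r ≤ ‖x - c‖ := by linarith
    have h1 := hout x hx4 hx'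
    have h2 : 0 < inner ℝ (G x) (x - c) := by
      have e : x - c = k • k⁻¹ • (x - c) := (smul_inv_smul₀ hk0.ne' _).symm
      have hn : 4 ≤ ‖k⁻¹ • (x - c)‖ := by
        rw [norm_smul, norm_inv, Real.norm_of_nonneg hk0.le, le_inv_mul_iff₀ hk0]
        linarith
      have := inner_model_pos hl admissible_final hn
      simp only [hG]
      nth_rewrite 2 [e]
      rw [real_inner_smul_left, real_inner_smul_right]
      positivity
    -- Both fields are outward in the collar, hence so is their convex combination.
    have e : F 1 x = (1 - ψ x) • F₀ x + ψ x • G x := by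
      simp only [hF, hH]
      module
    rw [e, inner_add_left, real_inner_smul_left, real_inner_smul_left]
    have p0 := ψ.nonneg (x := x)
    have p1 := ψ.le_one (x := x)
    rcases p0.lt_or_eq with hp | hp
    · have := mul_pos hp h2
      have := mul_nonneg (sub_nonneg.2 p1) h1.le
      linarith
    · rw [← hp]
      linarith

end MagneticGroup

theorem theorem3 (l : ℕ) (hl : 2 ≤ l) :
    (∀ (c : MagneticGroup.Space) (R : ℝ) (F₀ : MagneticGroup.Space → MagneticGroup.Space),
      MagneticGroup.PositivelyUnbalanced F₀ c R →
      MagneticGroup.HasCounts F₀ (Metric.closedBall c R) l (l - 1) 0 →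
      ∃ F : ℝ → MagneticGroup.Space → MagneticGroup.Space,
        F 0 = F₀ ∧
        MagneticGroup.IsContinuousFamily F (Metric.closedBall c R) ∧
        (∀ t ∈ Set.Icc (0 : ℝ) 1, MagneticGroup.PositivelyUnbalanced (F t) c R) ∧
        (∃ K : Set MagneticGroup.Space, IsCompact K ∧ K ⊆ Metric.ball c R ∧
          ∀ t ∈ Set.Icc (0 : ℝ) 1, ∀ x ∈ Metric.closedBall c R \ K, F t x = F₀ x) ∧
        MagneticGroup.HasCounts (F 1) (Metric.closedBall c R) l l 1 ∧
        MagneticGroup.separatorCount (F 1) (Metric.closedBall c R) = (l : ℕ∞)) ∧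
    (∃ (R : ℝ) (F : ℝ → MagneticGroup.Space → MagneticGroup.Space),
      MagneticGroup.IsContinuousFamily F (Metric.closedBall 0 R) ∧
      (∀ t ∈ Set.Icc (0 : ℝ) 1, MagneticGroup.PositivelyUnbalanced (F t) 0 R) ∧
      MagneticGroup.IsSaddleNodeBirth F R l ∧
      MagneticGroup.separatorCount (F 1) (Metric.closedBall 0 R) = (l : ℕ∞)) := by
  have hl1 : 1 ≤ l := by omega
  refine ⟨fun c R F₀ h₀ _ => ?_, 4, MagneticGroup.birthFamily l,
    MagneticGroup.isContinuousFamily_birthFamily l (by norm_num),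
    fun t ht => MagneticGroup.positivelyUnbalanced_birthFamily hl1 ht,
    MagneticGroup.isSaddleNodeBirth_birthFamily hl1,
    (MagneticGroup.containsModel_birthFamily hl1).separatorCount_eq hl⟩
  obtain ⟨F, h1, h2, h3, h4, k, hk⟩ := MagneticGroup.exists_family_to_containsModel hl1 h₀
  exact ⟨F, h1, h2, h3, h4, hk.hasCounts hl1, hk.separatorCount_eq hl⟩
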